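/- Let $n\ge 2$, let $x_1,\dots,x_{2n}$ be the coordinates of $\mathbb R^{2n}$, and let $$W_9=\{x\in\mathbb R^{2n}: x_1^2+x_2x_3^2=0,\ x_2^2+x_1x_3=0,\ x_4=\dots=x_{2n}=0\}.$$ Two germs at $0$ of smooth $2$-forms $\omega,\omega'$ on $\mathbb R^{2n}$ have the same algebraic restriction to $W_9$, written $[\omega]=[\omega']$, if $\omega-\omega'=\alpha+d\beta$ for germs at $0$ of a smooth $2$-form $\alpha$ and a smooth $1$-form $\beta$ that both vanish at every point of $W_9$. Put $$\theta_1=dx_2\wedge dx_3,\quad \theta_2=dx_1\wedge dx_3,\quad \theta_3=dx_1\wedge dx_2,\quad \theta_4=x_3\,dx_2\wedge dx_3,\quad \theta_5=x_3\,dx_1\wedge dx_3,$$ $$\theta_6=x_1\,dx_2\wedge dx_3+x_2\,dx_1\wedge dx_3,\quad \theta_7=x_3^2\,dx_2\wedge dx_3,\quad \theta_8=x_3^2\,dx_1\wedge dx_3,\quad \theta_9=x_3^3\,dx_2\wedge dx_3,$$ $$E=5x_1\frac{\partial}{\partial x_1}+4x_2\frac{\partial}{\partial x_2}+3x_3\frac{\partial}{\partial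 x_3},$$ $X_0=E$, $X_1=x_3E$, $X_2=x_2E$, $X_3=x_1E$, $X_4=x_3^2E$, $X_5=x_2x_3E$, $X_6=x_2^2E$, $X_7=x_1x_3E$, $X_8=x_1x_2E$, $X_9=x_3^3E$. Then each $X_i$ is tangent to $W_9$ (it maps function germs at $0$ vanishing on $W_9$ to such germs); the class $[\mathcal L_{X_i}\omega]$ depends only on $[\omega]$, so that $\mathcal L_{X_i}[\omega]:=[\mathcal L_{X_i}\omega]$ is well defined; the classes $[\theta_1],\dots,[\theta_9]$ form a basis of the real vector space of algebraic restrictions to $W_9$ of germs at $0$ of closed smooth $2$-forms; and the action of the $X_i$ on this basis is $$\begin{array}{l|ccccccccc} \mathcal L_{X_i}[\theta_j] & [\theta_1] & [\theta_2] & [\theta_3] & [\theta_4] & [\theta_5] & [\theta_6] & [\theta_7] & [\theta_8] & [\theta_9]\\ \hline X_0 & 7[\theta_1] & 8[\theta_2] & 9[\theta_3] & 10[\theta_4] & 11[\theta_5] & 12[\theta_6] & 13[\theta_7] & 14[\theta_8] & 16[\theta_9]\\ X_1 & 10[\theta_4] & 11[\theta_5] & 4[\theta_6] & 13[\theta_7]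 & 14[\theta_8] & 0 & 16[\theta_9] & 0 & 0\\ X_2 & -\frac{11}{2}[\theta_5] & 8[\theta_6] & \frac{13}{4}[\theta_7] & -7[\theta_8] & 0 & 12[\theta_9] & 0 & 0 & 0\\ X_3 & 4[\theta_6] & -\frac{13}{2}[\theta_7] & -7[\theta_8] & 0 & -8[\theta_9] & 0 & 0 & 0 & 0\\ X_4 & 13[\theta_7] & 14[\theta_8] & 0 & 16[\theta_9] & 0 & 0 & 0 & 0 & 0\\ X_5 & -7[\theta_8] & 0 & 4[\theta_9] & 0 & 0 & 0 & 0 & 0 & 0\\ X_6 & 0 & 8[\theta_9] & 0 & 0 & 0 & 0 & 0 & 0 & 0\\ X_7 & 0 & -8[\theta_9] & 0 & 0 & 0 & 0 & 0 & 0 & 0\\ X_8 & 4[\theta_9] & 0 & 0 & 0 & 0 & 0 & 0 & 0 & 0\\ X_9 & 16[\theta_9] & 0 & 0 & 0 & 0 & 0 & 0 & 0 & 0 \end{array}$$ -/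

import Mathlib

open Filter Topology

noncomputable section

namespace AlgebraicRestriction

/-- The space `ℝ^{2n}`. -/
abbrev R2n (n : ℕ) : Type := Fin (2 * n) → ℝ

variable {n p : ℕ}

/-- The map `f` is `C^∞` on a neighbourhood of the origin. Such maps represent the germs at the
origin of smooth maps: two of them represent the same germ iff they agree near the origin. -/
def SmoothNear {F : Type} [NormedAddCommGroup F] [NormedSpace ℝ F] (f : R2n n → F) : Prop :=
  ∀ᶠ x in 𝓝 (0 : R2n n), ContDiffAt ℝ (⊤ : ℕ∞) f x

/-- The map `f` vanishes at every point of the germ at the origin of the set `N`. -/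
def VanishesOn {F : Type} [Zero F] (f : R2n n → F) (N : Set (R2n n)) : Prop :=
  ∀ᶠ x in 𝓝 (0 : R2n n), x ∈ N → f x = 0

/-- Differential `p`-forms that are smooth near the origin of `ℝ^{2n}`. -/
@[ext]
structure Form (n p : ℕ) where
  toFun : R2n n → R2n n [⋀^Fin p]→L[ℝ] ℝ
  smooth : SmoothNear toFun

/-- Vector fields that are smooth near the origin of `ℝ^{2n}`. -/
structure VField (n : ℕ) where
  toFun : R2n n → R2n n
  smooth : SmoothNear toFun

namespace Form

instance : Zero (Form n p) := ⟨⟨0, Eventually.of_forall fun _ => contDiffAt_const⟩⟩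

instance : Add (Form n p) := ⟨fun ω ω' => ⟨ω.toFun + ω'.toFun, by
  filter_upwards [ω.smooth, ω'.smooth] with x h h' using h.add h'⟩⟩

instance : Neg (Form n p) := ⟨fun ω => ⟨-ω.toFun, by
  filter_upwards [ω.smooth] with x h using h.neg⟩⟩

instance : Sub (Form n p) := ⟨fun ω ω' => ⟨ω.toFun - ω'.toFun, by
  filter_upwards [ω.smooth, ω'.smooth] with x h h' using h.sub h'⟩⟩

instance : SMul ℝ (Form n p) := ⟨fun c ω => ⟨c • ω.toFun, by
  filter_upwards [ω.smooth] with x h using contDiffAt_const.smul h⟩⟩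

instance : SMul ℕ (Form n p) := ⟨fun c ω => ⟨c • ω.toFun, by
  filter_upwards [ω.smooth] with x h using h.const_smul c⟩⟩

instance : SMul ℤ (Form n p) := ⟨fun c ω => ⟨c • ω.toFun, by
  filter_upwards [ω.smooth] with x h using h.const_smul c⟩⟩

theorem toFun_injective : Function.Injective (toFun : Form n p → _) := fun _ _ h => Form.ext h

instance : AddCommGroup (Form n p) :=
  toFun_injective.addCommGroup toFun rfl (fun _ _ => rfl) (fun _ => rfl) (fun _ _ => rfl)
    (fun _ _ => rfl) (fun _ _ => rfl)

instance : Module ℝ (Form n p) :=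
  toFun_injective.module ℝ ⟨⟨toFun, rfl⟩, fun _ _ => rfl⟩ (fun _ _ => rfl)

@[simp] theorem toFun_zero : (0 : Form n p).toFun = 0 := rfl

@[simp] theorem toFun_add (ω ω' : Form n p) : (ω + ω').toFun = ω.toFun + ω'.toFun := rfl

@[simp] theorem toFun_sub (ω ω' : Form n p) : (ω - ω').toFun = ω.toFun - ω'.toFun := rfl

@[simp] theorem toFun_smul (c : ℝ) (ω : Form n p) : (c • ω).toFun = c • ω.toFun := rfl

/-- The exterior derivative `dω`. -/
def d (ω : Form n p) : Form n (p + 1) where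
  toFun := extDeriv ω.toFun
  smooth := by
    filter_upwards [ω.smooth] with x h
    exact (ContinuousAlternatingMap.alternatizeUncurryFinCLM ℝ (R2n n)
      ℝ).contDiff.contDiffAt.comp x
        (h.fderiv_right (m := ((⊤ : ℕ∞) : WithTop ℕ∞)) (by simp))

/-- The interior product `i_X ω = ω(X, ·, …, ·)`. -/
def interior (X : VField n) (ω : Form n (p + 1)) : Form n p where
  toFun x := (ω.toFun x).curryLeft (X.toFun x)
  smooth := by
    filter_upwards [X.smooth, ω.smooth] with x h1 h2
    have hL := ContinuousLinearMap.contDiff (n := ((⊤ : ℕ∞) : WithTop ℕ∞)) (𝕜 := ℝ)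
      (E := R2n n [⋀^Fin (p + 1)]→L[ℝ] ℝ) (F := R2n n →L[ℝ] R2n n [⋀^Fin p]→L[ℝ] ℝ)
      ContinuousAlternatingMap.curryLeftLI.toContinuousLinearMap
    have h3 := hL.contDiffAt.comp x h2
    exact h3.clm_apply h1

/-- The Lie derivative `L_X ω = d (i_X ω) + i_X (dω)` of a form of positive degree. -/
def lie (X : VField n) (ω : Form n (p + 1)) : Form n (p + 1) :=
  d (interior X ω) + interior X (d ω)

theorem d_zero : d (0 : Form n p) = 0 := by
  ext1
  funext x
  have h := extDeriv_smul (𝕜 := ℝ) (x := x) (0 : ℝ) (0 : R2n n → R2n n [⋀^Fin p]→L[ℝ] ℝ)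
  rw [zero_smul, zero_smul] at h
  exact h

theorem d_smul (c : ℝ) (ω : Form n p) : d (c • ω) = c • d ω := by
  ext1
  funext x
  exact extDeriv_smul c ω.toFun

/-- Additivity of `d` holds at the level of germs. -/
theorem d_add_eventuallyEq (α β : Form n p) :
    (d (α + β)).toFun =ᶠ[𝓝 0] (d α + d β).toFun := by
  filter_upwards [α.smooth, β.smooth] with x ha hb
  exact extDeriv_add (ha.differentiableAt (by simp)) (hb.differentiableAt (by simp))

end Form

/-- The forms with zero algebraic restriction to `N`: those whose germ at the origin is the germ
of `α + dβ` with `α` and `β` vanishing at every point of `N`. -/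
def zeroRestriction (N : Set (R2n n)) (p : ℕ) : Submodule ℝ (Form n (p + 1)) where
  carrier := {ω | ∃ (α : Form n (p + 1)) (β : Form n p),
    VanishesOn α.toFun N ∧ VanishesOn β.toFun N ∧ ω.toFun =ᶠ[𝓝 0] (α + β.d).toFun}
  add_mem' := by
    rintro ω ω' ⟨α, β, hα, hβ, h⟩ ⟨α', β', hα', hβ', h'⟩
    refine ⟨α + α', β + β', ?_, ?_, ?_⟩
    · filter_upwards [hα, hα'] with x h1 h2 hx
      simp [h1 hx, h2 hx]
    · filter_upwards [hβ, hβ'] with x h1 h2 hx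
      simp [h1 hx, h2 hx]
    · filter_upwards [h, h', Form.d_add_eventuallyEq β β'] with x h1 h2 h3
      simp only [Form.toFun_add, Pi.add_apply] at h1 h2 h3 ⊢
      rw [h1, h2, h3]
      abel
  zero_mem' := ⟨0, 0, Eventually.of_forall fun x _ => rfl, Eventually.of_forall fun x _ => rfl, by
    rw [Form.d_zero, add_zero]⟩
  smul_mem' := by
    rintro c ω ⟨α, β, hα, hβ, h⟩
    refine ⟨c • α, c • β, ?_, ?_, ?_⟩
    · filter_upwards [hα] with x h1 hx
      simp [h1 hx]
    · filter_upwards [hβ] with x h1 hx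
      simp [h1 hx]
    · filter_upwards [h] with x h1
      rw [Form.d_smul, ← smul_add, Form.toFun_smul, Form.toFun_smul, Pi.smul_apply,
        Pi.smul_apply, h1]

/-- The space of algebraic restrictions to `N` of germs of `(p+1)`-forms. -/
abbrev AlgRestr (N : Set (R2n n)) (p : ℕ) : Type := Form n (p + 1) ⧸ zeroRestriction N p

/-- The algebraic restriction `[ω]_N`. -/
def algRestr (N : Set (R2n n)) (ω : Form n (p + 1)) : AlgRestr N p :=
  (zeroRestriction N p).mkQ ω

/-- The algebraic restriction of a form depends only on its germ at the origin. -/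
theorem algRestr_eq_of_eventuallyEq (N : Set (R2n n)) {ω ω' : Form n (p + 1)}
    (h : ω.toFun =ᶠ[𝓝 0] ω'.toFun) : algRestr N ω = algRestr N ω' := by
  refine (Submodule.Quotient.eq _).2 ⟨ω - ω', 0, ?_, Eventually.of_forall fun x _ => rfl, ?_⟩
  · filter_upwards [h] with x hx _
    simp [hx]
  · rw [Form.d_zero, add_zero]

/-- The forms whose germ at the origin is closed. -/
def closedForms (n p : ℕ) : Submodule ℝ (Form n p) where
  carrier := {ω | ω.d.toFun =ᶠ[𝓝 0] 0}
  add_mem' := by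
    intro ω ω' h h'
    filter_upwards [h, h', Form.d_add_eventuallyEq ω ω'] with x h1 h2 h3
    rw [h3, Form.toFun_add, Pi.add_apply, h1, h2]
    simp
  zero_mem' := by
    change (Form.d 0).toFun =ᶠ[𝓝 0] 0
    rw [Form.d_zero, Form.toFun_zero]
  smul_mem' := by
    intro c ω h
    filter_upwards [h] with x h1
    rw [Form.d_smul, Form.toFun_smul, Pi.smul_apply, h1]
    simp

/-- The space of algebraic restrictions to `N` of germs of closed `(p+1)`-forms. -/
def closedAlgRestr (N : Set (R2n n)) (p : ℕ) : Submodule ℝ (AlgRestr N p) :=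
  (closedForms n (p + 1)).map (zeroRestriction N p).mkQ

/-- `X` is tangent to the germ at the origin of `N`: it maps function germs vanishing on `N` to
function germs vanishing on `N`. -/
def IsTangent (X : VField n) (N : Set (R2n n)) : Prop :=
  ∀ f : R2n n → ℝ, SmoothNear f → VanishesOn f N →
    VanishesOn (fun x => fderiv ℝ f x (X.toFun x)) N

/-- The wedge product of two linear forms. -/
def wedge (a b : R2n n →L[ℝ] ℝ) : R2n n [⋀^Fin 2]→L[ℝ] ℝ :=
  ContinuousMultilinearMap.alternatization
    ((ContinuousMultilinearMap.mkPiAlgebra ℝ (Fin 2) ℝ).compContinuousLinearMap ![a, b])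

theorem wedge_apply (a b : R2n n →L[ℝ] ℝ) (v : Fin 2 → R2n n) :
    wedge a b v = a (v 0) * b (v 1) - a (v 1) * b (v 0) := by
  have h : (Finset.univ : Finset (Equiv.Perm (Fin 2))) = {1, Equiv.swap 0 1} := by decide
  rw [wedge, ContinuousMultilinearMap.alternatization_apply_apply, h,
    Finset.sum_pair (by decide)]
  simp [Fin.prod_univ_two, sub_eq_add_neg]

/-- The position of the coordinate `x₁`, `x₂` or `x₃` (for `k = 0, 1, 2`) among the `2n ≥ 4`
coordinates of `ℝ^{2n}`. -/
def idx (hn : 2 ≤ n) (k : Fin 3) : Fin (2 * n) := Fin.castLE (by omega) k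

/-- The constant 2-form `dx_i ∧ dx_j`, where `i`, `j` are counted from `0`. -/
def dxdx (hn : 2 ≤ n) (i j : Fin 3) : R2n n [⋀^Fin 2]→L[ℝ] ℝ :=
  wedge (ContinuousLinearMap.proj (idx hn i)) (ContinuousLinearMap.proj (idx hn j))

/-- `W₉ = {x₁² + x₂ x₃² = x₂² + x₁ x₃ = x_{≥ 4} = 0} ⊆ ℝ^{2n}`. -/
def W9 (hn : 2 ≤ n) : Set (R2n n) :=
  {x | x (idx hn 0) ^ 2 + x (idx hn 1) * x (idx hn 2) ^ 2 = 0 ∧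
    x (idx hn 1) ^ 2 + x (idx hn 0) * x (idx hn 2) = 0 ∧
    ∀ k : Fin (2 * n), 3 ≤ (k : ℕ) → x k = 0}

/-- The values at `x` of the 2-forms `θ₁, …, θ₉`. -/
def w9FormAt (hn : 2 ≤ n) (x : R2n n) : Fin 9 → R2n n [⋀^Fin 2]→L[ℝ] ℝ :=
  let x₁ := x (idx hn 0)
  let x₂ := x (idx hn 1)
  let x₃ := x (idx hn 2)
  ![dxdx hn 1 2,
    dxdx hn 0 2,
    dxdx hn 0 1,
    x₃ • dxdx hn 1 2,
    x₃ • dxdx hn 0 2,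
    x₁ • dxdx hn 1 2 + x₂ • dxdx hn 0 2,
    x₃ ^ 2 • dxdx hn 1 2,
    x₃ ^ 2 • dxdx hn 0 2,
    x₃ ^ 3 • dxdx hn 1 2]

/-- The 2-forms `θ₁, …, θ₉`; `w9Form hn j` is `θ_{j+1}`. -/
def w9Form (hn : 2 ≤ n) (j : Fin 9) : Form n 2 :=
  ⟨fun x => w9FormAt hn x j, Eventually.of_forall fun x => ContDiff.contDiffAt (by
    fin_cases j <;> simp [w9FormAt] <;> fun_prop)⟩

/-- The Euler vector field `E = 5 x₁ ∂/∂x₁ + 4 x₂ ∂/∂x₂ + 3 x₃ ∂/∂x₃`. -/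
def w9Euler (hn : 2 ≤ n) (x : R2n n) : R2n n :=
  (5 * x (idx hn 0)) • Pi.single (idx hn 0) 1 + (4 * x (idx hn 1)) • Pi.single (idx hn 1) 1 +
    (3 * x (idx hn 2)) • Pi.single (idx hn 2) 1

/-- The values at `x` of the monomials `1, x₃, x₂, x₁, x₃², x₂x₃, x₂², x₁x₃, x₁x₂, x₃³`. -/
def w9MonomialAt (hn : 2 ≤ n) (x : R2n n) : Fin 10 → ℝ :=
  let x₁ := x (idx hn 0)
  let x₂ := x (idx hn 1)
  let x₃ := x (idx hn 2)
  ![1, x₃, x₂, x₁, x₃ ^ 2, x₂ * x₃, x₂ ^ 2, x₁ * x₃, x₁ * x₂, x₃ ^ 3]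

/-- The vector fields `X₀ = E`, `X₁ = x₃ E`, `X₂ = x₂ E`, `X₃ = x₁ E`, `X₄ = x₃² E`,
`X₅ = x₂ x₃ E`, `X₆ = x₂² E`, `X₇ = x₁ x₃ E`, `X₈ = x₁ x₂ E`, `X₉ = x₃³ E`. -/
def w9Field (hn : 2 ≤ n) (i : Fin 10) : VField n :=
  ⟨fun x => w9MonomialAt hn x i • w9Euler hn x, Eventually.of_forall fun x =>
    ContDiff.contDiffAt (by
      have hE : ContDiff ℝ (⊤ : ℕ∞) (w9Euler hn) := by
        change ContDiff ℝ (⊤ : ℕ∞) (fun x => w9Euler hn x)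
        simp only [w9Euler]
        fun_prop
      have hM : ContDiff ℝ (⊤ : ℕ∞) (fun x : R2n n => w9MonomialAt hn x i) := by
        fin_cases i <;> simp [w9MonomialAt] <;> fun_prop
      exact hM.smul hE)⟩

/-- The table of infinitesimal actions: the rows correspond to `X₀, …, X₉`, the columns to
`θ₁, …, θ₉`, and `t₁, …, t₉` stand for the algebraic restrictions of `θ₁, …, θ₉`. -/
def w9Table {V : Type*} [AddCommGroup V] [Module ℝ V] (t₁ t₂ t₃ t₄ t₅ t₆ t₇ t₈ t₉ : V) :
    Matrix (Fin 10) (Fin 9) V :=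
  !![(7 : ℝ) • t₁, (8 : ℝ) • t₂, (9 : ℝ) • t₃, (10 : ℝ) • t₄, (11 : ℝ) • t₅, (12 : ℝ) • t₆,
      (13 : ℝ) • t₇, (14 : ℝ) • t₈, (16 : ℝ) • t₉;
    (10 : ℝ) • t₄, (11 : ℝ) • t₅, (4 : ℝ) • t₆, (13 : ℝ) • t₇, (14 : ℝ) • t₈, 0,
      (16 : ℝ) • t₉, 0, 0;
    (-11 / 2 : ℝ) • t₅, (8 : ℝ) • t₆, (13 / 4 : ℝ) • t₇, (-7 : ℝ) • t₈, 0, (12 : ℝ) • t₉,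
      0, 0, 0;
    (4 : ℝ) • t₆, (-13 / 2 : ℝ) • t₇, (-7 : ℝ) • t₈, 0, (-8 : ℝ) • t₉, 0, 0, 0, 0;
    (13 : ℝ) • t₇, (14 : ℝ) • t₈, 0, (16 : ℝ) • t₉, 0, 0, 0, 0, 0;
    (-7 : ℝ) • t₈, 0, (4 : ℝ) • t₉, 0, 0, 0, 0, 0, 0;
    0, (8 : ℝ) • t₉, 0, 0, 0, 0, 0, 0, 0;
    0, (-8 : ℝ) • t₉, 0, 0, 0, 0, 0, 0, 0;
    (4 : ℝ) • t₉, 0, 0, 0, 0, 0, 0, 0, 0;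
    (16 : ℝ) • t₉, 0, 0, 0, 0, 0, 0, 0, 0]

end AlgebraicRestriction

end

open Filter Topology

noncomputable section

/-! Both equations of `W9` are quasi-homogeneous for the weights 5, 4, 3. The flow of E therefore
preserves `W9`, so E and all its multiples are tangent to it. Tangency makes the Lie derivative
preserve forms vanishing on `W9`. Since it also commutes with d, it preserves the forms α + dβ of
zero restriction and descends to the quotient (`w9Lie`).

Spanning. If f vanishes on `W9`, then f·τ and h df ∧ dx_i have zero restriction. Applied to the two
equations f₁, f₂ and to the coordinates beyond x₃, these relations reduce nonconstant monomial
forms, apart from x₂ dx₁ ∧ dx₃, to multiples of dx₂ ∧ dx₃ and kill everything of polynomial degree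
at least 4, with arbitrary smooth coefficients. With Hadamard's lemma, the θ_j together with x₁ dx₂
∧ dx₃ span all restrictions of 2-forms (`algRestr_mem_bigSpan`). Closedness removes the extra class:
functions vanishing on `W9` have no linear part in x₁, x₂, x₃, so no form of zero restriction can
compensate d(x₁ dx₂ ∧ dx₃) at the origin (`algRestr_mem_span_of_closed`).

The table follows by applying the same reductions to the Lie derivatives of monomial forms.

Independence. By the first row of the table the θ_j are eigenvectors of the action of E with
distinct eigenvalues, so it suffices that none is zero. The table sends every θ_j except θ₈ to a
nonzero multiple of θ₉, which leaves θ₈ and θ₉. If ω has zero restriction, then i_E ω equals dh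
along `W9` for some smooth h. Expanding the partial derivatives of h along the two branches (−t⁵,
−t⁴, t³) and (0, 0, t) of `W9` gives linear equations for the mixed derivatives of h at 0, and these
are inconsistent for θ₈ and θ₉. -/

namespace AlgebraicRestriction

/-! ### Hadamard's lemma for smooth germs -/

section SmoothParametric

section Hadamard

open MeasureTheory Set

variable {E F : Type} [NormedAddCommGroup E] [NormedSpace ℝ E]
  [NormedAddCommGroup F] [NormedSpace ℝ F]

theorem contDiff_fderiv_param {G : E → ℝ → F}
    (hG : ContDiff ℝ (⊤ : ℕ∞) (Function.uncurry G)) :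
    ContDiff ℝ (⊤ : ℕ∞) (Function.uncurry fun x t => fderiv ℝ (fun y => G y t) x) := by
  have h : ContDiff ℝ (⊤ : ℕ∞)
      (fun q : E × ℝ => fderiv ℝ (fun y => (fun (p : E × ℝ) (z : E) => G z p.2) q y) q.1) := by
    refine ContDiff.fderiv (n := (⊤ : ℕ∞)) (m := (⊤ : ℕ∞)) ?_ contDiff_fst (by simp)
    exact hG.comp (f := fun r : (E × ℝ) × E => (r.2, r.1.2)) (by fun_prop)
  exact h

theorem hasFDerivAt_integral_param [FiniteDimensional ℝ E] {G : E → ℝ → F}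
    (hG : ContDiff ℝ (⊤ : ℕ∞) (Function.uncurry G)) (x : E) :
    HasFDerivAt (fun x => ∫ t in (0 : ℝ)..1, G x t)
      (∫ t in (0 : ℝ)..1, fderiv ℝ (fun y => G y t) x) x := by
  have hG' := (contDiff_fderiv_param hG).continuous
  have : SecondCountableTopologyEither ℝ (E →L[ℝ] F) := secondCountableTopologyEither_of_left _ _
  have hc : IsCompact (Metric.closedBall x 1 ×ˢ Icc (0 : ℝ) 1) :=
    (isCompact_closedBall x 1).prod isCompact_Icc
  obtain ⟨C, hC⟩ := hc.exists_bound_of_continuousOn hG'.continuousOn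
  refine intervalIntegral.hasFDerivAt_integral_of_dominated_of_fderiv_le
    (bound := fun _ => C) (F' := fun x t => fderiv ℝ (fun y => G y t) x)
    (Metric.closedBall_mem_nhds x one_pos) ?_ ?_ ?_ ?_ ?_ ?_
  · refine Eventually.of_forall fun y => Continuous.aestronglyMeasurable ?_
    exact hG.continuous.comp (f := fun t => (y, t)) (by fun_prop)
  · refine Continuous.intervalIntegrable ?_ _ _
    exact hG.continuous.comp (f := fun t => (x, t)) (by fun_prop)
  · refine Continuous.aestronglyMeasurable ?_
    exact hG'.comp (f := fun t => (x, t)) (by fun_prop)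
  · refine Eventually.of_forall fun t ht y hy => hC (y, t) ⟨hy, ?_⟩
    rw [uIoc_of_le zero_le_one] at ht
    exact ⟨ht.1.le, ht.2⟩
  · exact intervalIntegrable_const
  · refine Eventually.of_forall fun t _ y _ => DifferentiableAt.hasFDerivAt ?_
    have h : ContDiff ℝ (⊤ : ℕ∞) (fun y => G y t) :=
      hG.comp (f := fun y => (y, t)) (by fun_prop)
    exact (h.differentiable (by simp)) y

/-- Differentiating under the integral gives an integral of the same kind with values in `E →L[ℝ]
F`. The induction on the order of smoothness therefore has to let the target space vary. -/
theorem contDiff_integral_param [FiniteDimensional ℝ E] {G : E → ℝ → F}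
    (hG : ContDiff ℝ (⊤ : ℕ∞) (Function.uncurry G)) :
    ContDiff ℝ (⊤ : ℕ∞) (fun x => ∫ t in (0 : ℝ)..1, G x t) := by
  rw [contDiff_infty]
  intro k
  induction k generalizing F with
  | zero =>
    exact contDiff_zero.2 (continuous_iff_continuousAt.2 fun x =>
      (hasFDerivAt_integral_param hG x).continuousAt)
  | succ k ih =>
    have h := contDiff_succ_iff_hasFDerivAt (𝕜 := ℝ) (n := k)
      (f := fun x => ∫ t in (0 : ℝ)..1, G x t)
    push_cast
    exact h.2 ⟨_, ih (contDiff_fderiv_param hG), fun x => hasFDerivAt_integral_param hG x⟩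

end Hadamard

variable {n : ℕ}

/-- A cut-off replaces the germ by a global function, so that integrals along the segments from 0 to
x are smooth in x without any restriction on x. -/
theorem exists_contDiff_eventuallyEq {g : R2n n → ℝ} (hg : SmoothNear g) :
    ∃ G : R2n n → ℝ, ContDiff ℝ (⊤ : ℕ∞) G ∧ g =ᶠ[𝓝 0] G := by
  obtain ⟨ε, hε, hs⟩ := Metric.eventually_nhds_iff_ball.1 hg
  let χ : ContDiffBump (0 : R2n n) := ⟨ε / 4, ε / 2, by positivity, by linarith⟩
  refine ⟨fun x => χ x * g x, contDiff_iff_contDiffAt.2 fun x => ?_, ?_⟩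
  · by_cases hx : x ∈ Metric.ball (0 : R2n n) ε
    · exact χ.contDiff.contDiffAt.mul (hs x hx)
    · have h0 : (fun x => χ x * g x) =ᶠ[𝓝 x] fun _ => 0 := by
        have : x ∉ tsupport χ := by
          rw [χ.tsupport_eq]
          intro h
          apply hx
          rw [Metric.mem_closedBall] at h
          rw [Metric.mem_ball]
          change dist x 0 ≤ ε / 2 at h
          linarith
        filter_upwards [notMem_tsupport_iff_eventuallyEq.1 this] with y hy
        simp [hy]
      exact contDiffAt_const.congr_of_eventuallyEq h0
  · filter_upwards [χ.eventuallyEq_one] with x hx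
    simp [hx]

/-- Hadamard's lemma. -/
theorem exists_eventually_eq_add_sum_mul {g : R2n n → ℝ} (hg : SmoothNear g) :
    ∃ G : Fin (2 * n) → R2n n → ℝ, (∀ i, SmoothNear (G i)) ∧
      ∀ᶠ x in 𝓝 0, g x = g 0 + ∑ i, x i * G i x := by
  obtain ⟨f, hf, hgf⟩ := exists_contDiff_eventuallyEq hg
  have hf' : ContDiff ℝ (⊤ : ℕ∞) (fderiv ℝ f) := hf.fderiv_right (by simp)
  refine ⟨fun i x => ∫ t in (0 : ℝ)..1, fderiv ℝ f (t • x) (Pi.single i 1), fun i => ?_, ?_⟩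
  · refine Eventually.of_forall fun x => (contDiff_integral_param ?_).contDiffAt
    exact (hf'.comp (f := fun q : R2n n × ℝ => q.2 • q.1) (by fun_prop)).clm_apply contDiff_const
  · filter_upwards [hgf] with x hx
    rw [hx, hgf.eq_of_nhds]
    have hd : ∀ t ∈ Set.uIcc (0 : ℝ) 1,
        HasDerivAt (fun t : ℝ => f (t • x)) (fderiv ℝ f (t • x) x) t := fun t _ => by
      have h1 : HasDerivAt (fun t : ℝ => t • x) x t := by
        simpa using (hasDerivAt_id t).smul_const x
      exact ((hf.differentiable (by simp)) (t • x)).hasFDerivAt.comp_hasDerivAt t h1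
    have hc : ∀ v, Continuous fun t : ℝ => fderiv ℝ f (t • x) v := fun v =>
      (hf'.continuous.comp (by fun_prop : Continuous fun t : ℝ => t • x)).clm_apply
        continuous_const
    have h := intervalIntegral.integral_eq_sub_of_hasDerivAt hd ((hc x).intervalIntegrable _ _)
    simp only [one_smul, zero_smul] at h
    rw [← sub_eq_iff_eq_add', ← h]
    simp only [← intervalIntegral.integral_const_mul]
    rw [← intervalIntegral.integral_finsetSum
      fun i _ => (by exact (continuous_const.mul (hc _)).intervalIntegrable _ _)]
    refine intervalIntegral.integral_congr fun t _ => ?_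
    conv_lhs => enter [2]; rw [← Finset.univ_sum_single x]
    rw [map_sum]
    refine Finset.sum_congr rfl fun i _ => ?_
    rw [show Pi.single i (x i) = x i • (Pi.single i 1 : R2n n) by
      rw [← Pi.single_smul, smul_eq_mul, mul_one], map_smul, smul_eq_mul]

end SmoothParametric

/-! ### Coordinate formulas for forms and the basic relation h df ∧ dx_i = 0 -/

section FormCalculus

variable {n p : ℕ}

theorem SmoothNear.fderiv {F : Type} [NormedAddCommGroup F] [NormedSpace ℝ F] {f : R2n n → F}
    (hf : SmoothNear f) : SmoothNear (_root_.fderiv ℝ f) := by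
  filter_upwards [hf] with x hx using hx.fderiv_right (by simp)

theorem SmoothNear.differentiableAt {F : Type} [NormedAddCommGroup F] [NormedSpace ℝ F]
    {f : R2n n → F} (hf : SmoothNear f) : ∀ᶠ x in 𝓝 0, DifferentiableAt ℝ f x := by
  filter_upwards [hf] with x hx using hx.differentiableAt (by simp)

/-- The algebra of functions that are smooth near the origin. -/
def smoothFns (n : ℕ) : Subalgebra ℝ (R2n n → ℝ) where
  carrier := {f | SmoothNear f}
  mul_mem' := fun hf hg => by filter_upwards [hf, hg] with x h1 h2 using h1.mul h2
  add_mem' := fun hf hg => by filter_upwards [hf, hg] with x h1 h2 using h1.add h2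
  algebraMap_mem' := fun _ => Eventually.of_forall fun _ => contDiffAt_const

/-- The coordinate function `x_i`. -/
def coord (i : Fin (2 * n)) : smoothFns n :=
  ⟨fun x => x i, Eventually.of_forall fun _ => by fun_prop⟩

@[simp] theorem coord_apply (i : Fin (2 * n)) (x : R2n n) : (coord i).1 x = x i := rfl

/-- The coordinate 1-form `dx_i`. -/
abbrev dx (i : Fin (2 * n)) : R2n n →L[ℝ] ℝ := ContinuousLinearMap.proj i

theorem wedge_add_left (a b c : R2n n →L[ℝ] ℝ) : wedge (a + b) c = wedge a c + wedge b c := by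
  ext v; simp [wedge_apply]; ring

theorem wedge_smul_left (r : ℝ) (a b : R2n n →L[ℝ] ℝ) : wedge (r • a) b = r • wedge a b := by
  ext v; simp [wedge_apply]; ring

theorem wedge_swap (a b : R2n n →L[ℝ] ℝ) : wedge a b = -wedge b a := by
  ext v; simp [wedge_apply]; ring

theorem contDiff_wedge_left (b : R2n n →L[ℝ] ℝ) :
    ContDiff ℝ (⊤ : ℕ∞) fun a : R2n n →L[ℝ] ℝ => wedge a b := by
  let L : (R2n n →L[ℝ] ℝ) →ₗ[ℝ] R2n n [⋀^Fin 2]→L[ℝ] ℝ :=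
    { toFun := fun a => wedge a b
      map_add' := fun a c => wedge_add_left a c b
      map_smul' := fun r a => wedge_smul_left r a b }
  exact (LinearMap.toContinuousLinearMap L).contDiff

/-- The factor 1/2 compensates for summing over all ordered pairs (i, j). -/
theorem eq_half_sum_wedge (ω : R2n n [⋀^Fin 2]→L[ℝ] ℝ) :
    ω = ∑ i, ∑ j, (ω ![Pi.single i 1, Pi.single j 1] / 2) • wedge (dx i) (dx j) := by
  have h : ∀ a b : R2n n, ω ![a, b] =
      ∑ i, ∑ j, a i * b j * ω ![Pi.single i 1, Pi.single j 1] := fun a b => by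
    have ha : a = ∑ i, a i • (Pi.single i 1 : R2n n) := by
      ext k; simp [Finset.sum_apply, Pi.single_apply]
    have hb : b = ∑ i, b i • (Pi.single i 1 : R2n n) := by
      ext k; simp [Finset.sum_apply, Pi.single_apply]
    have hu0 : ∀ c d e : R2n n, Function.update ![c, d] 0 e = ![e, d] := fun c d e => by
      ext i; fin_cases i <;> rfl
    have hu1 : ∀ c d e : R2n n, Function.update ![c, d] 1 e = ![c, e] := fun c d e => by
      ext i; fin_cases i <;> rfl
    have h1 : ∀ w, ω ![a, w] = ∑ i, a i * ω ![Pi.single i 1, w] := fun w => by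
      have := map_sum (ω.toMultilinearMap.toLinearMap ![a, w] 0)
        (fun i => a i • (Pi.single i 1 : R2n n)) Finset.univ
      rw [← ha] at this
      simpa [hu0] using this
    have h2 : ∀ w, ω ![w, b] = ∑ i, b i * ω ![w, Pi.single i 1] := fun w => by
      have := map_sum (ω.toMultilinearMap.toLinearMap ![w, b] 1)
        (fun i => b i • (Pi.single i 1 : R2n n)) Finset.univ
      rw [← hb] at this
      simpa [hu1] using this
    rw [h1]
    simp only [h2 (Pi.single _ _), Finset.mul_sum, mul_assoc]
  have hs : ∀ a b, ω ![a, b] = -ω ![b, a] := fun a b => by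
    have := ω.map_swap ![b, a] (i := 0) (j := 1) (by decide)
    refine Eq.trans (congrArg _ ?_) this
    ext i; fin_cases i <;> rfl
  ext v
  have hv : v = ![v 0, v 1] := by ext i; fin_cases i <;> rfl
  have h1 := h (v 0) (v 1)
  have h2 := h (v 1) (v 0)
  rw [hs, ← hv] at h2
  have h3 : ω v = (ω v - -ω v) / 2 := by ring
  rw [h3, h2]
  nth_rw 1 [hv]
  rw [h1]
  simp only [ContinuousAlternatingMap.sum_apply, ContinuousAlternatingMap.smul_apply, wedge_apply,
    ← Finset.sum_sub_distrib, Finset.sum_div]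
  refine Finset.sum_congr rfl fun i _ => Finset.sum_congr rfl fun j _ => ?_
  simp
  ring

/-- The form `g τ` with `τ` constant. -/
def smulConst (τ : R2n n [⋀^Fin p]→L[ℝ] ℝ) : smoothFns n →ₗ[ℝ] Form n p where
  toFun g := ⟨fun x => g.1 x • τ, by
    filter_upwards [g.2] with x hx using hx.smul contDiffAt_const⟩
  map_add' g h := by ext1; funext x; exact add_smul _ _ _
  map_smul' c g := by ext1; funext x; exact mul_smul _ _ _

theorem Form.d_apply_one (β : Form n 1) {x : R2n n} (v : Fin 2 → R2n n) :
    β.d.toFun x v = fderiv ℝ β.toFun x (v 0) ![v 1] - fderiv ℝ β.toFun x (v 1) ![v 0] := by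
  change ContinuousAlternatingMap.alternatizeUncurryFin (fderiv ℝ β.toFun x) v = _
  rw [ContinuousAlternatingMap.alternatizeUncurryFin_apply, Fin.sum_univ_two]
  have h0 : (0 : Fin 2).removeNth v = ![v 1] := by ext i; fin_cases i; rfl
  have h1 : (1 : Fin 2).removeNth v = ![v 0] := by ext i; fin_cases i; rfl
  rw [h0, h1]
  simp [sub_eq_add_neg]

theorem Form.d_apply_two (β : Form n 2) {x : R2n n} (v : Fin 3 → R2n n) :
    β.d.toFun x v = fderiv ℝ β.toFun x (v 0) ![v 1, v 2] - fderiv ℝ β.toFun x (v 1) ![v 0, v 2]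
      + fderiv ℝ β.toFun x (v 2) ![v 0, v 1] := by
  change ContinuousAlternatingMap.alternatizeUncurryFin (fderiv ℝ β.toFun x) v = _
  rw [ContinuousAlternatingMap.alternatizeUncurryFin_apply, Fin.sum_univ_three]
  have h0 : (0 : Fin 3).removeNth v = ![v 1, v 2] := by ext i; fin_cases i <;> rfl
  have h1 : (1 : Fin 3).removeNth v = ![v 0, v 2] := by ext i; fin_cases i <;> rfl
  have h2 : (2 : Fin 3).removeNth v = ![v 0, v 1] := by ext i; fin_cases i <;> rfl
  rw [h0, h1, h2]
  simp [sub_eq_add_neg]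

theorem fderiv_clm_apply_apply {E A B : Type*} [NormedAddCommGroup E] [NormedSpace ℝ E]
    [NormedAddCommGroup A] [NormedSpace ℝ A] [NormedAddCommGroup B] [NormedSpace ℝ B]
    (L : A →L[ℝ] E →L[ℝ] B) {ω : E → A} {X : E → E} {x : E} (hω : DifferentiableAt ℝ ω x)
    (hX : DifferentiableAt ℝ X x) (w : E) :
    fderiv ℝ (fun y => L (ω y) (X y)) x w =
      L (fderiv ℝ ω x w) (X x) + L (ω x) (fderiv ℝ X x w) := by
  have hL : HasFDerivAt (fun y => L (ω y)) (L ∘L fderiv ℝ ω x) x :=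
    L.hasFDerivAt.comp x hω.hasFDerivAt
  rw [(hL.clm_apply hX.hasFDerivAt).fderiv]
  simp [add_comm]

theorem fderiv_interior (X : VField n) (ω : Form n (p + 1)) {x : R2n n}
    (hX : DifferentiableAt ℝ X.toFun x) (hω : DifferentiableAt ℝ ω.toFun x) (w : R2n n)
    (v : Fin p → R2n n) :
    fderiv ℝ (Form.interior X ω).toFun x w v =
      fderiv ℝ ω.toFun x w (Matrix.vecCons (X.toFun x) v) +
        ω.toFun x (Matrix.vecCons (fderiv ℝ X.toFun x w) v) := by
  have h := fderiv_clm_apply_apply (A := R2n n [⋀^Fin (p + 1)]→L[ℝ] ℝ)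
    (B := R2n n [⋀^Fin p]→L[ℝ] ℝ)
    ContinuousAlternatingMap.curryLeftLI.toContinuousLinearMap hω hX w
  exact DFunLike.congr_fun h v

theorem lie_apply_one (X : VField n) (β : Form n 1) {x : R2n n}
    (hX : DifferentiableAt ℝ X.toFun x) (hβ : DifferentiableAt ℝ β.toFun x) (v : Fin 1 → R2n n) :
    (β.lie X).toFun x v = fderiv ℝ β.toFun x (X.toFun x) v +
      β.toFun x ![fderiv ℝ X.toFun x (v 0)] := by
  have h1 : ((Form.interior X β).d).toFun x v =
      fderiv ℝ (Form.interior X β).toFun x (v 0) ![] := by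
    change ContinuousAlternatingMap.alternatizeUncurryFin
      (fderiv ℝ (Form.interior X β).toFun x) v = _
    rw [ContinuousAlternatingMap.alternatizeUncurryFin_apply]
    simp
    congr 1
    exact Subsingleton.elim _ _
  have h2 : (Form.interior X β.d).toFun x v = β.d.toFun x (Matrix.vecCons (X.toFun x) v) := rfl
  have hv : v = ![v 0] := by ext i; fin_cases i; rfl
  change ((Form.interior X β).d).toFun x v + (Form.interior X β.d).toFun x v = _
  rw [h1, h2, fderiv_interior X β hX hβ, Form.d_apply_one]
  rw [hv]
  simp
  ring

/-- In Cartan's formula the derivatives of ω in directions other than X cancel. Only ∂_X ω and the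
values of ω remain, which is why vanishing along a set is inherited when X is tangent to it. -/
theorem lie_apply_two (X : VField n) (ω : Form n 2) {x : R2n n}
    (hX : DifferentiableAt ℝ X.toFun x) (hω : DifferentiableAt ℝ ω.toFun x) (v : Fin 2 → R2n n) :
    (ω.lie X).toFun x v = fderiv ℝ ω.toFun x (X.toFun x) v +
      ω.toFun x ![fderiv ℝ X.toFun x (v 0), v 1] + ω.toFun x ![v 0, fderiv ℝ X.toFun x (v 1)] := by
  have h2 : (Form.interior X ω.d).toFun x v = ω.d.toFun x (Matrix.vecCons (X.toFun x) v) := rfl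
  have hv : v = ![v 0, v 1] := by ext i; fin_cases i <;> rfl
  have hs : ∀ a b, ω.toFun x ![a, b] = -ω.toFun x ![b, a] := fun a b => by
    have := (ω.toFun x).map_swap ![b, a] (i := 0) (j := 1) (by decide)
    refine Eq.trans (congrArg _ ?_) this
    ext i; fin_cases i <;> rfl
  change ((Form.interior X ω).d).toFun x v + (Form.interior X ω.d).toFun x v = _
  rw [h2, Form.d_apply_one, fderiv_interior X ω hX hω, fderiv_interior X ω hX hω,
    Form.d_apply_two]
  rw [hv]
  simp
  rw [hs (v 0)]
  ring

theorem algRestr_add (N : Set (R2n n)) (ω ω' : Form n (p + 1)) :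
    algRestr N (ω + ω') = algRestr N ω + algRestr N ω' := map_add _ _ _

theorem algRestr_eq_zero_iff {N : Set (R2n n)} {ω : Form n (p + 1)} :
    algRestr N ω = 0 ↔ ω ∈ zeroRestriction N p :=
  Submodule.Quotient.mk_eq_zero _

/-- By the Leibniz rule h df ∧ dx_i = −f dh ∧ dx_i + d(h f dx_i), and both f dh ∧ dx_i and h f dx_i
vanish on N. -/
theorem algRestr_eq_zero_of_wedge_fderiv {N : Set (R2n n)} {ω : Form n 2} (f h : smoothFns n)
    (hf : VanishesOn f.1 N) (i : Fin (2 * n))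
    (hω : ω.toFun =ᶠ[𝓝 0] fun x => h.1 x • wedge (fderiv ℝ f.1 x) (dx i)) :
    algRestr N ω = 0 := by
  refine algRestr_eq_zero_iff.2 ⟨⟨fun x => -(f.1 x • wedge (fderiv ℝ h.1 x) (dx i)), ?_⟩,
    smulConst (p := 1) (ContinuousAlternatingMap.ofSubsingleton ℝ (R2n n) ℝ 0 (dx i)) (h * f), ?_, ?_, ?_⟩
  · filter_upwards [f.2, h.2.fderiv] with x h1 h2
    exact (h1.smul ((contDiff_wedge_left _).contDiffAt.comp x h2)).neg
  · filter_upwards [hf] with x h1 hx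
    simp [h1 hx]
  · filter_upwards [hf] with x h1 hx
    simp [smulConst, h1 hx]
  · filter_upwards [hω, h.2.differentiableAt, f.2.differentiableAt] with x hx hh hf
    rw [hx]
    have hd : fderiv ℝ (smulConst (p := 1) (ContinuousAlternatingMap.ofSubsingleton ℝ (R2n n) ℝ 0 (dx i))
        (h * f)).toFun x = (h.1 x • fderiv ℝ f.1 x + f.1 x • fderiv ℝ h.1 x).smulRight
        (ContinuousAlternatingMap.ofSubsingleton ℝ (R2n n) ℝ 0 (dx i)) :=
      (HasFDerivAt.smul_const (F := R2n n [⋀^Fin 1]→L[ℝ] ℝ)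
        (hh.hasFDerivAt.mul hf.hasFDerivAt) _).fderiv
    ext v
    rw [Form.toFun_add, Pi.add_apply, ContinuousAlternatingMap.add_apply, Form.d_apply_one, hd]
    simp [wedge_apply]
    ring

theorem algRestr_eq_zero_of_vanishesOn {N : Set (R2n n)} {ω : Form n (p + 1)}
    (hω : VanishesOn ω.toFun N) : algRestr N ω = 0 :=
  algRestr_eq_zero_iff.2 ⟨ω, 0, hω, Eventually.of_forall fun _ _ => rfl, by
    rw [Form.d_zero, add_zero]⟩

/-- The class of `g dx_i ∧ dx_j`. -/
def coefClass (N : Set (R2n n)) (i j : Fin (2 * n)) : smoothFns n →ₗ[ℝ] AlgRestr N 1 :=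
  (zeroRestriction N 1).mkQ ∘ₗ smulConst (wedge (dx i) (dx j))

end FormCalculus

/-! ### Tangency of the fields and their action on algebraic restrictions -/

section LieAction

variable {n p : ℕ}

/-- The weights `5, 4, 3` of the coordinates `x₁, x₂, x₃`. -/
def weight : ℕ → ℝ
  | 0 => 5
  | 1 => 4
  | 2 => 3
  | _ => 0

theorem w9Euler_apply (hn : 2 ≤ n) (x : R2n n) (k : Fin (2 * n)) :
    w9Euler hn x k = weight k * x k := by
  obtain ⟨k, hk⟩ := k
  match k with
  | 0 => simp [w9Euler, weight, idx, Pi.single_apply, Fin.ext_iff]; rfl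
  | 1 => simp [w9Euler, weight, idx, Pi.single_apply, Fin.ext_iff]; rfl
  | 2 => simp [w9Euler, weight, idx, Pi.single_apply, Fin.ext_iff]; rfl
  | k + 3 => simp [w9Euler, weight, idx, Fin.ext_iff]

/-- The two equations are quasi-homogeneous of degrees 10 and 8, so the flow multiplies them by
exp(10s) and exp(8s). -/
theorem flow_mem_W9 (hn : 2 ≤ n) {x : R2n n} (hx : x ∈ W9 hn) (s : ℝ) :
    (fun k : Fin (2 * n) => Real.exp (s * weight k) * x k) ∈ W9 hn := by
  obtain ⟨h1, h2, h3⟩ := hx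
  have e0 : Real.exp (s * 5) = Real.exp s ^ 5 := by rw [mul_comm, ← Real.exp_nat_mul]; norm_num
  have e1 : Real.exp (s * 4) = Real.exp s ^ 4 := by rw [mul_comm, ← Real.exp_nat_mul]; norm_num
  have e2 : Real.exp (s * 3) = Real.exp s ^ 3 := by rw [mul_comm, ← Real.exp_nat_mul]; norm_num
  refine ⟨?_, ?_, fun k hk => by simp [h3 k hk]⟩
  · simp only [idx, Fin.val_castLE, weight, e0, e1, e2, Fin.val_zero, Fin.val_one, Fin.val_two]
      at h1 ⊢
    linear_combination Real.exp s ^ 10 * h1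
  · simp only [idx, Fin.val_castLE, weight, e0, e1, e2, Fin.val_zero, Fin.val_one, Fin.val_two]
      at h2 ⊢
    linear_combination Real.exp s ^ 8 * h2

/-- The integral curve of E through a point of `W9` stays in `W9`, so f is zero along it near that
point and its derivative at s = 0 vanishes. Vector-valued f are allowed so that the result applies
to forms. -/
theorem VanishesOn.fderiv_euler (hn : 2 ≤ n) {F : Type} [NormedAddCommGroup F] [NormedSpace ℝ F]
    {f : R2n n → F} (hf : SmoothNear f) (hv : VanishesOn f (W9 hn)) :
    VanishesOn (fun x => fderiv ℝ f x (w9Euler hn x)) (W9 hn) := by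
  filter_upwards [hf.differentiableAt, hv.eventually_nhds] with x hd hx hxN
  have hc : HasDerivAt (fun s : ℝ => (fun k : Fin (2 * n) => Real.exp (s * weight k) * x k : R2n n))
      (w9Euler hn x) 0 := by
    rw [hasDerivAt_pi]
    intro k
    rw [w9Euler_apply]
    have := (((hasDerivAt_id (0 : ℝ)).mul_const (weight k)).exp).mul_const (x k)
    simpa using this
  have h0 : (fun k : Fin (2 * n) => Real.exp ((0 : ℝ) * weight k) * x k : R2n n) = x := by ext k; simp
  have hd' : HasFDerivAt f (fderiv ℝ f x) (fun k : Fin (2 * n) => Real.exp ((0 : ℝ) * weight k) * x k) := by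
    rw [h0]; exact hd.hasFDerivAt
  have h1 := hd'.comp_hasDerivAt (0 : ℝ) hc
  have hz : (f ∘ fun s : ℝ => (fun k : Fin (2 * n) => Real.exp (s * weight k) * x k : R2n n)) =ᶠ[𝓝 0]
      fun _ => 0 := by
    have ht := hc.continuousAt.tendsto
    rw [h0] at ht
    filter_upwards [ht.eventually hx] with s hs using hs (flow_mem_W9 hn hxN s)
  exact h1.unique ((hasDerivAt_const (0 : ℝ) (0 : F)).congr_of_eventuallyEq hz)

theorem VanishesOn.fderiv_w9Field (hn : 2 ≤ n) (i : Fin 10) {F : Type} [NormedAddCommGroup F]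
    [NormedSpace ℝ F] {f : R2n n → F} (hf : SmoothNear f) (hv : VanishesOn f (W9 hn)) :
    VanishesOn (fun x => fderiv ℝ f x ((w9Field hn i).toFun x)) (W9 hn) := by
  filter_upwards [VanishesOn.fderiv_euler hn hf hv] with x hx hxN
  have : (w9Field hn i).toFun x = w9MonomialAt hn x i • w9Euler hn x := rfl
  simp only [this, map_smul, hx hxN, smul_zero]

theorem isTangent_w9Field (hn : 2 ≤ n) (i : Fin 10) : IsTangent (w9Field hn i) (W9 hn) :=
  fun _ hf hv => hv.fderiv_w9Field hn i hf

theorem VanishesOn.lie_one (hn : 2 ≤ n) (i : Fin 10) {β : Form n 1}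
    (hv : VanishesOn β.toFun (W9 hn)) :
    VanishesOn (β.lie (w9Field hn i)).toFun (W9 hn) := by
  filter_upwards [hv, VanishesOn.fderiv_w9Field hn i β.smooth hv,
    β.smooth.differentiableAt, (w9Field hn i).smooth.differentiableAt] with x h1 h2 hβ hX hx
  ext v
  rw [lie_apply_one _ _ hX hβ, h2 hx, h1 hx]
  simp

theorem VanishesOn.lie_two (hn : 2 ≤ n) (i : Fin 10) {ω : Form n 2}
    (hv : VanishesOn ω.toFun (W9 hn)) :
    VanishesOn (ω.lie (w9Field hn i)).toFun (W9 hn) := by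
  filter_upwards [hv, VanishesOn.fderiv_w9Field hn i ω.smooth hv,
    ω.smooth.differentiableAt, (w9Field hn i).smooth.differentiableAt] with x h1 h2 hβ hX hx
  ext v
  rw [lie_apply_two _ _ hX hβ, h2 hx, h1 hx]
  simp

theorem Form.d_congr {ω ω' : Form n p} (h : ω.toFun =ᶠ[𝓝 0] ω'.toFun) :
    ω.d.toFun =ᶠ[𝓝 0] ω'.d.toFun := h.extDeriv

theorem Form.interior_congr (X : VField n) {ω ω' : Form n (p + 1)}
    (h : ω.toFun =ᶠ[𝓝 0] ω'.toFun) :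
    (Form.interior X ω).toFun =ᶠ[𝓝 0] (Form.interior X ω').toFun := by
  filter_upwards [h] with x hx
  simp only [Form.interior, hx]

theorem Form.lie_congr (X : VField n) {ω ω' : Form n (p + 1)} (h : ω.toFun =ᶠ[𝓝 0] ω'.toFun) :
    (ω.lie X).toFun =ᶠ[𝓝 0] (ω'.lie X).toFun :=
  (Form.d_congr (Form.interior_congr X h)).add (Form.interior_congr X (Form.d_congr h))

theorem Form.lie_add (X : VField n) (ω ω' : Form n (p + 1)) :
    ((ω + ω').lie X).toFun =ᶠ[𝓝 0] (ω.lie X + ω'.lie X).toFun := by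
  have h1 : Form.interior X (ω + ω') = Form.interior X ω + Form.interior X ω' := by
    ext x v; simp [Form.interior]
  filter_upwards [Form.d_add_eventuallyEq (Form.interior X ω) (Form.interior X ω'),
    Form.d_add_eventuallyEq ω ω'] with x hx hx'
  simp only [Form.lie, Form.toFun_add, Pi.add_apply, h1] at hx hx' ⊢
  rw [hx]
  have h2 : (Form.interior X (ω + ω').d).toFun x =
      (Form.interior X ω.d).toFun x + (Form.interior X ω'.d).toFun x := by
    ext v; simp [Form.interior, hx']
  rw [h2]
  abel

theorem Form.lie_smul (X : VField n) (c : ℝ) (ω : Form n (p + 1)) :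
    (c • ω).lie X = c • ω.lie X := by
  have h1 : ∀ {q : ℕ} (ω : Form n (q + 1)),
      Form.interior X (c • ω) = c • Form.interior X ω := fun ω => by
    ext x v; simp [Form.interior]
  rw [Form.lie, Form.lie, h1, Form.d_smul, Form.d_smul, h1, smul_add]

theorem Form.d_d (ω : Form n p) : ω.d.d.toFun =ᶠ[𝓝 0] 0 := by
  filter_upwards [ω.smooth] with x hx
  exact extDeriv_extDeriv_apply hx
    (by
    rw [minSmoothness_of_isRCLikeNormedField]
    exact WithTop.coe_le_coe.2 (le_top : (2 : ℕ∞) ≤ ⊤))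

/-- Since d² = 0, both sides reduce to d i_X dβ. -/
theorem Form.lie_d (X : VField n) (β : Form n (p + 1)) :
    (β.d.lie X).toFun =ᶠ[𝓝 0] (β.lie X).d.toFun := by
  have h1 : (β.lie X).d.toFun =ᶠ[𝓝 0] _ :=
    Form.d_add_eventuallyEq (Form.interior X β).d (Form.interior X β.d)
  filter_upwards [h1, (Form.interior X β).d_d, β.d_d] with x h1 h2 h3
  rw [h1]
  simp only [Form.lie, Form.toFun_add, Pi.add_apply, h2]
  simp [Form.interior, h3]

/-- The map sending `ω` to the algebraic restriction of `L_X ω`. -/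
def algRestrLie (N : Set (R2n n)) (X : VField n) : Form n (p + 1) →ₗ[ℝ] AlgRestr N p where
  toFun ω := algRestr N (ω.lie X)
  map_add' ω ω' := by
    rw [algRestr_eq_of_eventuallyEq N (Form.lie_add X ω ω')]
    exact map_add _ _ _
  map_smul' c ω := by
    rw [Form.lie_smul]
    exact map_smul _ _ _

/-- L_X(α + dβ) = L_X α + d(L_X β), and L_X α, L_X β vanish on `W9` again. -/
theorem algRestr_lie_eq_zero (hn : 2 ≤ n) (i : Fin 10) {ω : Form n 2}
    (hω : ω ∈ zeroRestriction (W9 hn) 1) : algRestr (W9 hn) (ω.lie (w9Field hn i)) = 0 := by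
  obtain ⟨α, β, hα, hβ, h⟩ := hω
  rw [algRestr_eq_zero_iff]
  refine ⟨α.lie (w9Field hn i), β.lie (w9Field hn i), hα.lie_two hn i, hβ.lie_one hn i, ?_⟩
  refine (Form.lie_congr _ h).trans ((Form.lie_add _ _ _).trans ?_)
  exact EventuallyEq.add (EventuallyEq.refl _ _) (Form.lie_d _ _)

/-- The action of `X_i` on algebraic restrictions. -/
def w9Lie (hn : 2 ≤ n) (i : Fin 10) : Module.End ℝ (AlgRestr (W9 hn) 1) :=
  (zeroRestriction (W9 hn) 1).liftQ (algRestrLie (W9 hn) (w9Field hn i))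
    fun _ hω => algRestr_lie_eq_zero hn i hω

theorem w9Lie_algRestr (hn : 2 ≤ n) (i : Fin 10) (ω : Form n 2) :
    w9Lie hn i (algRestr (W9 hn) ω) = algRestr (W9 hn) (ω.lie (w9Field hn i)) := rfl

end LieAction

/-! ### Relations between the classes of monomial forms -/

section Relations

variable {n p : ℕ}

section CoefClass

variable {N : Set (R2n n)}

theorem coefClass_swap (i j : Fin (2 * n)) (g : smoothFns n) :
    coefClass N i j g = -coefClass N j i g := by
  rw [coefClass, coefClass, LinearMap.comp_apply, LinearMap.comp_apply, ← map_neg]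
  congr 1
  ext1
  funext x
  change g.1 x • wedge (dx i) (dx j) = -(g.1 x • wedge (dx j) (dx i))
  rw [wedge_swap, smul_neg]

theorem coefClass_self (i : Fin (2 * n)) (g : smoothFns n) : coefClass N i i g = 0 := by
  have h := coefClass_swap (N := N) i i g
  have h2 : (2 : ℝ) • coefClass N i i g = 0 := by
    rw [two_smul]; nth_rw 1 [h]; exact neg_add_cancel _
  exact (smul_eq_zero.1 h2).resolve_left two_ne_zero

theorem coefClass_congr (i j : Fin (2 * n)) {g g' : smoothFns n} (h : g.1 =ᶠ[𝓝 0] g'.1) :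
    coefClass N i j g = coefClass N i j g' := by
  refine algRestr_eq_of_eventuallyEq N ?_
  filter_upwards [h] with x hx
  exact congrArg (· • wedge (dx i) (dx j)) hx

theorem coefClass_eq_zero (i j : Fin (2 * n)) {g : smoothFns n} (h : VanishesOn g.1 N) :
    coefClass N i j g = 0 := by
  refine algRestr_eq_zero_of_vanishesOn ?_
  filter_upwards [h] with x hx hxN
  change g.1 x • wedge (dx i) (dx j) = 0
  rw [hx hxN, zero_smul]

/-- The relation `h df ∧ dx_i = 0` for `f` vanishing on `N`, where `df = ∑ c_l dx_{s l}`. -/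
theorem sum_coefClass_eq_zero {f : smoothFns n} (hf : VanishesOn f.1 N) {ι : Type} [Fintype ι]
    (s : ι → Fin (2 * n)) (c : ι → smoothFns n)
    (hc : ∀ x, HasFDerivAt f.1 (∑ l, (c l).1 x • dx (s l)) x) (i : Fin (2 * n))
    (h : smoothFns n) : ∑ l, coefClass N (s l) i (c l * h) = 0 := by
  have h1 : ∑ l, coefClass N (s l) i (c l * h) =
      algRestr N (∑ l, smulConst (wedge (dx (s l)) (dx i)) (c l * h)) :=
    (map_sum (zeroRestriction N 1).mkQ _ _).symm
  rw [h1]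
  refine algRestr_eq_zero_of_wedge_fderiv f h hf i (Eventually.of_forall fun x => ?_)
  have h2 : ∀ t : Finset ι, (∑ l ∈ t, smulConst (wedge (dx (s l)) (dx i)) (c l * h)).toFun x =
      h.1 x • wedge (∑ l ∈ t, (c l).1 x • dx (s l)) (dx i) := fun t => by
    classical
    induction t using Finset.induction_on with
    | empty => ext v; simp [wedge_apply]
    | insert a t ha ih =>
      rw [Finset.sum_insert ha, Finset.sum_insert ha, wedge_add_left, wedge_smul_left, smul_add,
        ← ih, Form.toFun_add, Pi.add_apply, smul_smul]
      congr 1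
      exact congrArg (· • wedge (dx (s a)) (dx i)) (mul_comm ((c a).1 x) (h.1 x))
  simp only [h2, (hc x).fderiv]

end CoefClass

variable (hn : 2 ≤ n)

/-- This is the relation h df ∧ dx_i = 0 for f = x_j, which vanishes on `W9`. -/
theorem coefClass_eq_zero_right {j : Fin (2 * n)} (hj : 3 ≤ (j : ℕ)) (i : Fin (2 * n))
    (g : smoothFns n) : coefClass (W9 hn) i j g = 0 := by
  have h := sum_coefClass_eq_zero (N := W9 hn) (f := coord j)
    (Eventually.of_forall fun x hx => hx.2.2 j hj) (ι := Unit) (fun _ => j) (fun _ => 1)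
    (fun x => by
      simp only [Finset.univ_unique, Finset.sum_singleton, OneMemClass.coe_one, Pi.one_apply,
        one_smul]
      exact (dx j).hasFDerivAt) i g
  rw [coefClass_swap, neg_eq_zero]
  simpa using h

/-- The functions `x₁`, `x₂`, `x₃`. -/
def X (k : Fin 3) : smoothFns n := coord (idx hn k)

/-- The class of `x₁^a x₂^b x₃^c h dx_k ∧ dx_l`. -/
def monoClass (k l : Fin 3) (h : smoothFns n) (a b c : ℕ) : AlgRestr (W9 hn) 1 :=
  coefClass (W9 hn) (idx hn k) (idx hn l) (X hn 0 ^ a * X hn 1 ^ b * X hn 2 ^ c * h)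

theorem monoClass_swap (k l : Fin 3) (h : smoothFns n) (a b c : ℕ) :
    monoClass hn k l h a b c = -monoClass hn l k h a b c := coefClass_swap _ _ _

theorem monoClass_self (k : Fin 3) (h : smoothFns n) (a b c : ℕ) :
    monoClass hn k k h a b c = 0 := coefClass_self _ _

theorem hasFDerivAt_X (k : Fin 3) (x : R2n n) : HasFDerivAt (X hn k).1 (dx (idx hn k)) x :=
  (dx (idx hn k)).hasFDerivAt

/-- Here df₁ = 2x₁ dx₁ + x₃² dx₂ + 2x₂x₃ dx₃ is multiplied by a monomial times h and wedged with the
chosen coordinate differential. -/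
theorem monoClass_rel_df₁ (i : Fin 3) (h : smoothFns n) (a b c : ℕ) :
    (2 : ℝ) • monoClass hn 0 i h (a + 1) b c + monoClass hn 1 i h a b (c + 2) +
      (2 : ℝ) • monoClass hn 2 i h a (b + 1) (c + 1) = 0 := by
  have key := sum_coefClass_eq_zero (N := W9 hn) (f := X hn 0 ^ 2 + X hn 1 * X hn 2 ^ 2)
    (Eventually.of_forall fun x hx => hx.1) (idx hn)
    ![(2 : ℝ) • X hn 0, X hn 2 ^ 2, (2 : ℝ) • (X hn 1 * X hn 2)] (fun x => by
      refine (((hasFDerivAt_X hn 0 x).pow 2).add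
        ((hasFDerivAt_X hn 1 x).mul ((hasFDerivAt_X hn 2 x).pow 2))).congr_fderiv ?_
      ext v
      simp [Fin.sum_univ_three, X]
      ring) (idx hn i) (X hn 0 ^ a * X hn 1 ^ b * X hn 2 ^ c * h)
  simp only [Fin.sum_univ_three, Matrix.cons_val, smul_mul_assoc, map_smul] at key
  rw [← key]
  unfold monoClass
  rw [show X hn 0 ^ (a + 1) * X hn 1 ^ b * X hn 2 ^ c * h =
      X hn 0 * (X hn 0 ^ a * X hn 1 ^ b * X hn 2 ^ c * h) by ring,
    show X hn 0 ^ a * X hn 1 ^ b * X hn 2 ^ (c + 2) * h =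
      X hn 2 ^ 2 * (X hn 0 ^ a * X hn 1 ^ b * X hn 2 ^ c * h) by ring,
    show X hn 0 ^ a * X hn 1 ^ (b + 1) * X hn 2 ^ (c + 1) * h =
      X hn 1 * X hn 2 * (X hn 0 ^ a * X hn 1 ^ b * X hn 2 ^ c * h) by ring]

theorem monoClass_rel_df₂ (i : Fin 3) (h : smoothFns n) (a b c : ℕ) :
    monoClass hn 0 i h a b (c + 1) + (2 : ℝ) • monoClass hn 1 i h a (b + 1) c +
      monoClass hn 2 i h (a + 1) b c = 0 := by
  have key := sum_coefClass_eq_zero (N := W9 hn) (f := X hn 1 ^ 2 + X hn 0 * X hn 2)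
    (Eventually.of_forall fun x hx => hx.2.1) (idx hn)
    ![X hn 2, (2 : ℝ) • X hn 1, X hn 0] (fun x => by
      refine (((hasFDerivAt_X hn 1 x).pow 2).add
        ((hasFDerivAt_X hn 0 x).mul (hasFDerivAt_X hn 2 x))).congr_fderiv ?_
      ext v
      simp [Fin.sum_univ_three, X]
      ring) (idx hn i) (X hn 0 ^ a * X hn 1 ^ b * X hn 2 ^ c * h)
  simp only [Fin.sum_univ_three, Matrix.cons_val, smul_mul_assoc, map_smul] at key
  rw [← key]
  unfold monoClass
  rw [show X hn 0 ^ a * X hn 1 ^ b * X hn 2 ^ (c + 1) * h =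
      X hn 2 * (X hn 0 ^ a * X hn 1 ^ b * X hn 2 ^ c * h) by ring,
    show X hn 0 ^ a * X hn 1 ^ (b + 1) * X hn 2 ^ c * h =
      X hn 1 * (X hn 0 ^ a * X hn 1 ^ b * X hn 2 ^ c * h) by ring,
    show X hn 0 ^ (a + 1) * X hn 1 ^ b * X hn 2 ^ c * h =
      X hn 0 * (X hn 0 ^ a * X hn 1 ^ b * X hn 2 ^ c * h) by ring]

theorem monoClass_rel_f₁ (k l : Fin 3) (h : smoothFns n) (a b c : ℕ) :
    monoClass hn k l h (a + 2) b c + monoClass hn k l h a (b + 1) (c + 2) = 0 := by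
  rw [monoClass, monoClass, ← map_add]
  refine coefClass_eq_zero _ _ (Eventually.of_forall fun x hx => ?_)
  have h1 := hx.1
  change x (idx hn 0) ^ (a + 2) * x (idx hn 1) ^ b * x (idx hn 2) ^ c * h.1 x +
    x (idx hn 0) ^ a * x (idx hn 1) ^ (b + 1) * x (idx hn 2) ^ (c + 2) * h.1 x = 0
  linear_combination x (idx hn 0) ^ a * x (idx hn 1) ^ b * x (idx hn 2) ^ c * h.1 x * h1

theorem monoClass_rel_f₂ (k l : Fin 3) (h : smoothFns n) (a b c : ℕ) :
    monoClass hn k l h a (b + 2) c + monoClass hn k l h (a + 1) b (c + 1) = 0 := by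
  rw [monoClass, monoClass, ← map_add]
  refine coefClass_eq_zero _ _ (Eventually.of_forall fun x hx => ?_)
  have h1 := hx.2.1
  change x (idx hn 0) ^ a * x (idx hn 1) ^ (b + 2) * x (idx hn 2) ^ c * h.1 x +
    x (idx hn 0) ^ (a + 1) * x (idx hn 1) ^ b * x (idx hn 2) ^ (c + 1) * h.1 x = 0
  linear_combination x (idx hn 0) ^ a * x (idx hn 1) ^ b * x (idx hn 2) ^ c * h.1 x * h1

/-! ### Reduction to multiples of dx₂ ∧ dx₃ and vanishing in degree at least 4 -/

section Reduction

variable (h : smoothFns n) (a b c : ℕ)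

/-- Wedging df₂ with dx₃ removes its dx₃ term, so just two terms remain. The other reductions with
`dx` on the left arise in the same way from df₁, df₂ and the three coordinate differentials. -/
theorem monoClass_02_right :
    monoClass hn 0 2 h a b (c + 1) = (-2 : ℝ) • monoClass hn 1 2 h a (b + 1) c := by
  have h1 := monoClass_rel_df₂ hn 2 h a b c
  rw [monoClass_self] at h1
  linear_combination (norm := module) h1

theorem monoClass_02_left :
    monoClass hn 0 2 h (a + 1) b c = (-1 / 2 : ℝ) • monoClass hn 1 2 h a b (c + 2) := by
  have h1 := monoClass_rel_df₁ hn 2 h a b c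
  rw [monoClass_self] at h1
  linear_combination (norm := module) (1 / 2 : ℝ) • h1

theorem monoClass_02_mid :
    monoClass hn 0 2 h a (b + 2) c = (2 : ℝ) • monoClass hn 1 2 h (a + 1) (b + 1) c := by
  have h1 := monoClass_rel_f₂ hn 0 2 h a b c
  rw [monoClass_02_right] at h1
  linear_combination (norm := module) h1

theorem monoClass_01_right :
    monoClass hn 0 1 h a b (c + 1) = monoClass hn 1 2 h (a + 1) b c := by
  have h1 := monoClass_rel_df₂ hn 1 h a b c
  rw [monoClass_self, monoClass_swap hn 2 1] at h1
  linear_combination (norm := module) h1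

theorem monoClass_01_left :
    monoClass hn 0 1 h (a + 1) b c = monoClass hn 1 2 h a (b + 1) (c + 1) := by
  have h1 := monoClass_rel_df₁ hn 1 h a b c
  rw [monoClass_self, monoClass_swap hn 2 1] at h1
  linear_combination (norm := module) (1 / 2 : ℝ) • h1

theorem monoClass_01_mid :
    monoClass hn 0 1 h a (b + 1) c = (1 / 4 : ℝ) • monoClass hn 1 2 h a b (c + 2) := by
  have h1 := monoClass_rel_df₂ hn 0 h a b c
  rw [monoClass_self, monoClass_swap hn 2 0, monoClass_swap hn 1 0, monoClass_02_left] at h1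
  linear_combination (norm := module) (-1 / 2 : ℝ) • h1

/-- The relation df₁ ∧ dx₁ = 0, rewritten in terms of dx₂ ∧ dx₃, says x₁x₃ = 4x₂², while f₂ = 0 says
x₂² = −x₁x₃. Together they give 5x₁x₃ = 0. -/
theorem monoClass_12_zero_xz : monoClass hn 1 2 h (a + 1) b (c + 1) = 0 := by
  have h1 := monoClass_rel_df₁ hn 0 h a b c
  rw [monoClass_self, monoClass_swap hn 1 0, monoClass_swap hn 2 0, monoClass_02_right,
    monoClass_01_right] at h1
  have h2 := monoClass_rel_f₂ hn 1 2 h a b c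
  linear_combination (norm := module) (-1 / 5 : ℝ) • h1 + (4 / 5 : ℝ) • h2

theorem monoClass_12_zero_yy : monoClass hn 1 2 h a (b + 2) c = 0 := by
  have h2 := monoClass_rel_f₂ hn 1 2 h a b c
  rwa [monoClass_12_zero_xz, add_zero] at h2

/-- The form x₁x₃ dx₁ ∧ dx₂, times a monomial, can be reduced by lowering either x₃ or x₁.
Comparison gives x₁² = x₂x₃² on dx₂ ∧ dx₃. As f₁ = 0 gives the opposite sign, both coefficients kill
the class. -/
theorem monoClass_12_xx_eq :
    monoClass hn 1 2 h (a + 2) b c = monoClass hn 1 2 h a (b + 1) (c + 2) := by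
  rw [← monoClass_01_right, monoClass_01_left]

theorem monoClass_12_zero_xx : monoClass hn 1 2 h (a + 2) b c = 0 := by
  have h1 := monoClass_rel_f₁ hn 1 2 h a b c
  rw [← monoClass_12_xx_eq] at h1
  linear_combination (norm := module) (1 / 2 : ℝ) • h1

theorem monoClass_12_zero_yzz : monoClass hn 1 2 h a (b + 1) (c + 2) = 0 := by
  rw [← monoClass_12_xx_eq, monoClass_12_zero_xx]

theorem monoClass_12_xy :
    monoClass hn 1 2 h (a + 1) (b + 1) c = (1 / 4 : ℝ) • monoClass hn 1 2 h a b (c + 3) := by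
  rw [← monoClass_01_right, monoClass_01_mid]

/-- On dx₂ ∧ dx₃ one has x₃⁴ = 4x₁x₂x₃, and x₁x₃ already gives zero. -/
theorem monoClass_12_zero_zzzz : monoClass hn 1 2 h a b (c + 4) = 0 := by
  have h1 := monoClass_12_xy hn h a b (c + 1)
  rw [monoClass_12_zero_xz] at h1
  linear_combination (norm := module) (-4 : ℝ) • h1

/-- The monomials divisible by none of x₁², x₂², x₁x₃, x₂x₃², x₃⁴ have degree at most 3. Because h
is arbitrary, the vanishing covers smooth remainders and not only polynomials. -/
theorem monoClass_12_eq_zero (hd : 4 ≤ a + b + c) : monoClass hn 1 2 h a b c = 0 := by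
  match a, b, c with
  | a + 2, b, c => exact monoClass_12_zero_xx ..
  | a, b + 2, c => exact monoClass_12_zero_yy ..
  | a + 1, b, c + 1 => exact monoClass_12_zero_xz ..
  | a, b + 1, c + 2 => exact monoClass_12_zero_yzz ..
  | a, b, c + 4 => exact monoClass_12_zero_zzzz ..

theorem monoClass_02_eq_zero (hd : 4 ≤ a + b + c) : monoClass hn 0 2 h a b c = 0 := by
  match a, b, c with
  | a, b, c + 1 => rw [monoClass_02_right, monoClass_12_eq_zero _ _ _ _ _ (by omega), smul_zero]
  | a + 1, b, c => rw [monoClass_02_left, monoClass_12_eq_zero _ _ _ _ _ (by omega), smul_zero]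
  | a, b + 2, c => rw [monoClass_02_mid, monoClass_12_eq_zero _ _ _ _ _ (by omega), smul_zero]

theorem monoClass_01_eq_zero (hd : 4 ≤ a + b + c) : monoClass hn 0 1 h a b c = 0 := by
  match a, b, c with
  | a, b, c + 1 => rw [monoClass_01_right, monoClass_12_eq_zero _ _ _ _ _ (by omega)]
  | a + 1, b, c => rw [monoClass_01_left, monoClass_12_eq_zero _ _ _ _ _ (by omega)]
  | a, b + 1, c => rw [monoClass_01_mid, monoClass_12_eq_zero _ _ _ _ _ (by omega), smul_zero]

end Reduction

end Relations

/-! ### Lie derivatives of monomial forms along monomial multiples of E -/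

section LieMonomials

variable {n : ℕ} (hn : 2 ≤ n)

/-- The exponents of the monomials `1, x₃, x₂, x₁, x₃², x₂x₃, x₂², x₁x₃, x₁x₂, x₃³`. -/
def expo : Fin 10 → Fin 3 → ℕ :=
  ![![0, 0, 0], ![0, 0, 1], ![0, 1, 0], ![1, 0, 0], ![0, 0, 2], ![0, 1, 1], ![0, 2, 0],
    ![1, 0, 1], ![1, 1, 0], ![0, 0, 3]]

theorem w9MonomialAt_eq (x : R2n n) (i : Fin 10) :
    w9MonomialAt hn x i = x (idx hn 0) ^ expo i 0 * x (idx hn 1) ^ expo i 1 *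
      x (idx hn 2) ^ expo i 2 := by
  fin_cases i <;> simp [w9MonomialAt, expo]

/-- The monomial `x₁^a x₂^b x₃^c`. -/
def monoAt (a b c : ℕ) (x : R2n n) : ℝ :=
  x (idx hn 0) ^ a * x (idx hn 1) ^ b * x (idx hn 2) ^ c

/-- The differential of the monomial `x₁^a x₂^b x₃^c`. -/
def dmonoAt (a b c : ℕ) (x : R2n n) : R2n n →L[ℝ] ℝ :=
  (a * monoAt hn (a - 1) b c x) • dx (idx hn 0) + (b * monoAt hn a (b - 1) c x) • dx (idx hn 1) +
    (c * monoAt hn a b (c - 1) x) • dx (idx hn 2)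

theorem hasFDerivAt_monoAt (a b c : ℕ) (x : R2n n) :
    HasFDerivAt (monoAt hn a b c) (dmonoAt hn a b c x) x := by
  refine ((((hasFDerivAt_X hn 0 x).pow a).mul ((hasFDerivAt_X hn 1 x).pow b)).mul
    ((hasFDerivAt_X hn 2 x).pow c)).congr_fderiv ?_
  ext v
  simp [dmonoAt, X, monoAt]
  ring

theorem dmonoAt_euler (a b c : ℕ) (x : R2n n) :
    dmonoAt hn a b c x (w9Euler hn x) = (5 * a + 4 * b + 3 * c) * monoAt hn a b c x := by
  have h : ∀ (r : ℝ) (k : ℕ), k * r ^ (k - 1) * r = k * r ^ k := fun r k => by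
    cases k with
    | zero => simp
    | succ k => simp [pow_succ, mul_assoc]
  simp only [dmonoAt, add_apply, smul_apply, smul_eq_mul,
    ContinuousLinearMap.proj_apply, w9Euler_apply, monoAt]
  rw [show weight (idx hn 0 : Fin (2 * n)) = 5 from rfl,
    show weight (idx hn 1 : Fin (2 * n)) = 4 from rfl,
    show weight (idx hn 2 : Fin (2 * n)) = 3 from rfl]
  have h0 := h (x (idx hn 0)) a
  have h1 := h (x (idx hn 1)) b
  have h2 := h (x (idx hn 2)) c
  generalize x (idx hn 0) = x₀ at *
  generalize x (idx hn 1) = x₁ at *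
  generalize x (idx hn 2) = x₂ at *
  linear_combination 5 * x₁ ^ b * x₂ ^ c * h0 + 4 * x₀ ^ a * x₂ ^ c * h1 +
    3 * x₀ ^ a * x₁ ^ b * h2

theorem hasFDerivAt_w9Field_apply (i : Fin 10) (x : R2n n) (k : Fin (2 * n)) :
    HasFDerivAt (fun y => (w9Field hn i).toFun y k)
      (monoAt hn (expo i 0) (expo i 1) (expo i 2) x • (weight k • dx k) +
        (weight k * x k) • dmonoAt hn (expo i 0) (expo i 1) (expo i 2) x) x := by
  have h1 : (fun y => (w9Field hn i).toFun y k) =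
      fun y => monoAt hn (expo i 0) (expo i 1) (expo i 2) y * (weight k * y k) := by
    funext y
    change w9MonomialAt hn y i * w9Euler hn y k = _
    rw [w9MonomialAt_eq, w9Euler_apply, monoAt]
  rw [h1]
  exact (hasFDerivAt_monoAt hn _ _ _ x).mul ((dx k).hasFDerivAt.const_mul (weight k))

theorem differentiableAt_w9Field (i : Fin 10) (x : R2n n) :
    DifferentiableAt ℝ (w9Field hn i).toFun x :=
  differentiableAt_pi.2 fun k => (hasFDerivAt_w9Field_apply hn i x k).differentiableAt

theorem fderiv_w9Field (i : Fin 10) (x v : R2n n) (k : Fin (2 * n)) :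
    fderiv ℝ (w9Field hn i).toFun x v k =
      dmonoAt hn (expo i 0) (expo i 1) (expo i 2) x v * (weight k * x k) +
        monoAt hn (expo i 0) (expo i 1) (expo i 2) x * (weight k * v k) := by
  have h := (hasFDerivAt_pi'.1 (differentiableAt_w9Field hn i x).hasFDerivAt k).unique
    (hasFDerivAt_w9Field_apply hn i x k)
  have h' := DFunLike.congr_fun h v
  simp only [ContinuousLinearMap.comp_apply, ContinuousLinearMap.proj_apply] at h'
  rw [h']
  simp
  ring

/-- The exponent of `x_q` in `x_k`. -/
def delta (k q : Fin 3) : ℕ := if k = q then 1 else 0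

/-- For X = mE the component X_k is w_k m x_k, so dX_k = w_k (m dx_k + x_k dm). The first term
collects X(f) dx_k ∧ dx_l and the m dx_k, m dx_l contributions; the other six expand the two dm
terms. When an exponent of m is 0, the truncated subtraction is harmless because its coefficient is
0. -/
theorem w9Lie_monoClass (i : Fin 10) (k l : Fin 3) (a b c : ℕ) :
    w9Lie hn i (monoClass hn k l 1 a b c) =
      (5 * a + 4 * b + 3 * c + weight k + weight l : ℝ) •
        monoClass hn k l 1 (expo i 0 + a) (expo i 1 + b) (expo i 2 + c) +
      (weight k * expo i 0 : ℝ) • monoClass hn 0 l 1 (expo i 0 - 1 + a + delta k 0)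
        (expo i 1 + b + delta k 1) (expo i 2 + c + delta k 2) +
      (weight k * expo i 1 : ℝ) • monoClass hn 1 l 1 (expo i 0 + a + delta k 0)
        (expo i 1 - 1 + b + delta k 1) (expo i 2 + c + delta k 2) +
      (weight k * expo i 2 : ℝ) • monoClass hn 2 l 1 (expo i 0 + a + delta k 0)
        (expo i 1 + b + delta k 1) (expo i 2 - 1 + c + delta k 2) +
      (weight l * expo i 0 : ℝ) • monoClass hn k 0 1 (expo i 0 - 1 + a + delta l 0)
        (expo i 1 + b + delta l 1) (expo i 2 + c + delta l 2) +
      (weight l * expo i 1 : ℝ) • monoClass hn k 1 1 (expo i 0 + a + delta l 0)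
        (expo i 1 - 1 + b + delta l 1) (expo i 2 + c + delta l 2) +
      (weight l * expo i 2 : ℝ) • monoClass hn k 2 1 (expo i 0 + a + delta l 0)
        (expo i 1 + b + delta l 1) (expo i 2 - 1 + c + delta l 2) := by
  have hX : ∀ (k : Fin 3) (x : R2n n), x (idx hn k) =
      x (idx hn 0) ^ delta k 0 * x (idx hn 1) ^ delta k 1 * x (idx hn 2) ^ delta k 2 :=
    fun k x => by fin_cases k <;> simp [delta]
  have hk : ∀ k : Fin 3, ((idx hn k : Fin (2 * n)) : ℕ) = k := fun k => rfl
  simp only [monoClass, coefClass, LinearMap.comp_apply, ← map_smul, ← map_add]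
  refine (w9Lie_algRestr hn i _).trans (congrArg _ ?_)
  ext x v
  have hθ : HasFDerivAt (smulConst (wedge (dx (idx hn k)) (dx (idx hn l)))
      (X hn 0 ^ a * X hn 1 ^ b * X hn 2 ^ c * 1)).toFun
      ((dmonoAt hn a b c x).smulRight (wedge (dx (idx hn k)) (dx (idx hn l)))) x := by
    have h1 : (smulConst (wedge (dx (idx hn k)) (dx (idx hn l)))
        (X hn 0 ^ a * X hn 1 ^ b * X hn 2 ^ c * 1)).toFun =
        fun y => monoAt hn a b c y • wedge (dx (idx hn k)) (dx (idx hn l)) := by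
      funext y
      rw [mul_one]
      rfl
    rw [h1]
    exact HasFDerivAt.smul_const (F := R2n n [⋀^Fin 2]→L[ℝ] ℝ) (hasFDerivAt_monoAt hn a b c x) _
  have hv : (w9Field hn i).toFun x =
      monoAt hn (expo i 0) (expo i 1) (expo i 2) x • w9Euler hn x :=
    congrArg (· • w9Euler hn x) (w9MonomialAt_eq hn x i)
  have hs : ∀ (τ : R2n n [⋀^Fin 2]→L[ℝ] ℝ) (p q r : ℕ),
      (smulConst τ (X hn 0 ^ p * X hn 1 ^ q * X hn 2 ^ r * 1)).toFun x v =
        monoAt hn p q r x * τ v := fun τ p q r => by rw [mul_one]; rfl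
  rw [lie_apply_two _ _ (differentiableAt_w9Field hn i x) hθ.differentiableAt, hθ.fderiv, hv]
  simp only [Form.toFun_add, Form.toFun_smul, Pi.add_apply, Pi.smul_apply,
    ContinuousAlternatingMap.add_apply, ContinuousAlternatingMap.smul_apply, hs,
    ContinuousLinearMap.smulRight_apply, map_smul, dmonoAt_euler, smul_eq_mul]
  rw [mul_one]
  change _ + monoAt hn a b c x * wedge _ _ _ + monoAt hn a b c x * wedge _ _ _ = _
  simp only [wedge_apply, ContinuousLinearMap.proj_apply, Matrix.cons_val, fderiv_w9Field,
    hX k x, hX l x, hk]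
  simp only [dmonoAt, add_apply, smul_apply, smul_eq_mul, ContinuousLinearMap.proj_apply]
  simp only [monoAt, pow_add]
  ring

end LieMonomials

/-! ### The table of infinitesimal actions -/

section Table

variable {n : ℕ} (hn : 2 ≤ n)

/-- The algebraic restrictions of `θ₁, …, θ₉`. -/
def theta (j : Fin 9) : AlgRestr (W9 hn) 1 := algRestr (W9 hn) (w9Form hn j)

theorem monoClass_one (k l : Fin 3) (a b c : ℕ) :
    monoClass hn k l 1 a b c =
      algRestr (W9 hn) (smulConst (dxdx hn k l) (X hn 0 ^ a * X hn 1 ^ b * X hn 2 ^ c)) := by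
  rw [monoClass, mul_one]
  rfl

theorem theta_eq (j : Fin 9) : theta hn j =
    ![monoClass hn 1 2 1 0 0 0, monoClass hn 0 2 1 0 0 0, monoClass hn 0 1 1 0 0 0,
      monoClass hn 1 2 1 0 0 1, monoClass hn 0 2 1 0 0 1,
      monoClass hn 1 2 1 1 0 0 + monoClass hn 0 2 1 0 1 0,
      monoClass hn 1 2 1 0 0 2, monoClass hn 0 2 1 0 0 2, monoClass hn 1 2 1 0 0 3] j := by
  have key : ∀ (k l : Fin 3) (a b c : ℕ),
      (∀ x, w9FormAt hn x j = monoAt hn a b c x • dxdx hn k l) →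
      theta hn j = monoClass hn k l 1 a b c := fun k l a b c h => by
    rw [monoClass_one]
    exact algRestr_eq_of_eventuallyEq _ (Eventually.of_forall h)
  by_cases hj : j = 5
  · subst hj
    simp only [monoClass_one]
    refine Eq.trans ?_ (algRestr_add _ _ _)
    refine algRestr_eq_of_eventuallyEq _ (Eventually.of_forall fun x => ?_)
    change _ = monoAt hn 1 0 0 x • dxdx hn 1 2 + monoAt hn 0 1 0 x • dxdx hn 0 2
    simp [monoAt, w9Form, w9FormAt]
  · fin_cases j
    all_goals first
      | exact absurd rfl hj
      | exact key _ _ _ _ _ fun x => by simp [w9FormAt, monoAt]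

-- The reduction relations, read from left to right, bring each of the 90 Lie derivatives to a form
-- where only linear algebra remains.
set_option maxHeartbeats 2000000 in
theorem w9Lie_theta (i : Fin 10) (j : Fin 9) :
    w9Lie hn i (theta hn j) = w9Table (theta hn 0) (theta hn 1) (theta hn 2) (theta hn 3)
      (theta hn 4) (theta hn 5) (theta hn 6) (theta hn 7) (theta hn 8) i j := by
  -- All θ_j are written with k < l, so these are the only reversed pairs that the Lie derivative
  -- formula produces. Fixing the indices keeps the swap from looping as a rewrite rule.
  have h10 := monoClass_swap hn 1 0 1
  have h21 := monoClass_swap hn 2 1 1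
  simp only [theta_eq]
  fin_cases j <;> fin_cases i <;>
    simp [w9Table, w9Lie_monoClass, expo, delta, weight, monoClass_self, h10, h21,
      monoClass_02_right, monoClass_02_left, monoClass_02_mid, monoClass_01_right,
      monoClass_01_left, monoClass_01_mid, monoClass_12_zero_xz, monoClass_12_zero_yy,
      monoClass_12_zero_xx, monoClass_12_zero_yzz, monoClass_12_zero_zzzz, monoClass_12_xy] <;>
    module

end Table

/-! ### Generators for the algebraic restrictions of all 2-forms -/

section Spanning

variable {n : ℕ} (hn : 2 ≤ n)

theorem monoClass_eq_zero (k l : Fin 3) (h : smoothFns n) (a b c : ℕ) (hd : 4 ≤ a + b + c) :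
    monoClass hn k l h a b c = 0 := by
  fin_cases k <;> fin_cases l
  · exact monoClass_self ..
  · exact monoClass_01_eq_zero _ _ _ _ _ hd
  · exact monoClass_02_eq_zero _ _ _ _ _ hd
  · exact (monoClass_swap ..).trans (neg_eq_zero.2 (monoClass_01_eq_zero _ _ _ _ _ hd))
  · exact monoClass_self ..
  · exact monoClass_12_eq_zero _ _ _ _ _ hd
  · exact (monoClass_swap ..).trans (neg_eq_zero.2 (monoClass_02_eq_zero _ _ _ _ _ hd))
  · exact (monoClass_swap ..).trans (neg_eq_zero.2 (monoClass_12_eq_zero _ _ _ _ _ hd))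
  · exact monoClass_self ..

/-- The span of the nine classes `θ_j` and of the class of `x₁ dx₂ ∧ dx₃`. -/
def bigSpan : Submodule ℝ (AlgRestr (W9 hn) 1) :=
  Submodule.span ℝ (Set.range (theta hn)) ⊔ ℝ ∙ monoClass hn 1 2 1 1 0 0

theorem theta_mem_bigSpan (j : Fin 9) : theta hn j ∈ bigSpan hn :=
  Submodule.mem_sup_left (Submodule.subset_span ⟨j, rfl⟩)

theorem mem_bigSpan_of_theta_eq {j : Fin 9} {m : AlgRestr (W9 hn) 1} (h : theta hn j = m) :
    m ∈ bigSpan hn := h ▸ theta_mem_bigSpan hn j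

theorem monoClass_12_one_mem (a b c : ℕ) : monoClass hn 1 2 1 a b c ∈ bigSpan hn := by
  have h3 : ∀ c, monoClass hn 1 2 1 0 0 c ∈ bigSpan hn := fun c => by
    match c with
    | 0 => exact mem_bigSpan_of_theta_eq hn (theta_eq hn 0)
    | 1 => exact mem_bigSpan_of_theta_eq hn (theta_eq hn 3)
    | 2 => exact mem_bigSpan_of_theta_eq hn (theta_eq hn 6)
    | 3 => exact mem_bigSpan_of_theta_eq hn (theta_eq hn 8)
    | c + 4 => rw [monoClass_12_zero_zzzz]; exact zero_mem _
  have h2 : ∀ c, monoClass hn 0 2 1 0 0 (c + 1) ∈ bigSpan hn →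
      monoClass hn 1 2 1 0 1 c ∈ bigSpan hn := fun c hc => by
    rw [monoClass_02_right] at hc
    exact ((bigSpan hn).smul_mem_iff (by norm_num)).1 hc
  match a, b, c with
  | a + 2, b, c => rw [monoClass_12_zero_xx]; exact zero_mem _
  | a, b + 2, c => rw [monoClass_12_zero_yy]; exact zero_mem _
  | 1, 0, 0 => exact Submodule.mem_sup_right (Submodule.mem_span_singleton_self _)
  | 1, b, c + 1 => rw [monoClass_12_zero_xz]; exact zero_mem _
  | 1, 1, 0 => rw [monoClass_12_xy]; exact (bigSpan hn).smul_mem _ (h3 3)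
  | 0, 1, 0 => exact h2 0 (mem_bigSpan_of_theta_eq hn (theta_eq hn 4))
  | 0, 1, 1 => exact h2 1 (mem_bigSpan_of_theta_eq hn (theta_eq hn 7))
  | 0, 1, c + 2 => rw [monoClass_12_zero_yzz]; exact zero_mem _
  | 0, 0, c => exact h3 c

theorem monoClass_02_one_mem (a b c : ℕ) : monoClass hn 0 2 1 a b c ∈ bigSpan hn := by
  match a, b, c with
  | a, b, c + 1 =>
    rw [monoClass_02_right]; exact Submodule.smul_mem _ _ (monoClass_12_one_mem hn _ _ _)
  | a + 1, b, c =>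
    rw [monoClass_02_left]; exact Submodule.smul_mem _ _ (monoClass_12_one_mem hn _ _ _)
  | a, b + 2, c =>
    rw [monoClass_02_mid]; exact Submodule.smul_mem _ _ (monoClass_12_one_mem hn _ _ _)
  | 0, 0, 0 => exact mem_bigSpan_of_theta_eq hn (theta_eq hn 1)
  | 0, 1, 0 =>
    have h : monoClass hn 1 2 1 1 0 0 + monoClass hn 0 2 1 0 1 0 ∈ bigSpan hn :=
      mem_bigSpan_of_theta_eq hn (theta_eq hn 5)
    exact (Submodule.add_mem_iff_right _ (monoClass_12_one_mem hn _ _ _)).1 h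

theorem monoClass_01_one_mem (a b c : ℕ) : monoClass hn 0 1 1 a b c ∈ bigSpan hn := by
  match a, b, c with
  | a, b, c + 1 => rw [monoClass_01_right]; exact monoClass_12_one_mem hn _ _ _
  | a + 1, b, c => rw [monoClass_01_left]; exact monoClass_12_one_mem hn _ _ _
  | a, b + 1, c =>
    rw [monoClass_01_mid]; exact Submodule.smul_mem _ _ (monoClass_12_one_mem hn _ _ _)
  | 0, 0, 0 => exact mem_bigSpan_of_theta_eq hn (theta_eq hn 2)

theorem monoClass_one_mem (k l : Fin 3) (a b c : ℕ) : monoClass hn k l 1 a b c ∈ bigSpan hn := by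
  have h0 : ∀ k, monoClass hn k k 1 a b c ∈ bigSpan hn := fun k => by
    rw [monoClass_self]; exact zero_mem _
  have h1 : ∀ k l, monoClass hn k l 1 a b c ∈ bigSpan hn →
      monoClass hn l k 1 a b c ∈ bigSpan hn := fun k l h => by
    rw [monoClass_swap]; exact neg_mem h
  fin_cases k <;> fin_cases l
  · exact h0 _
  · exact monoClass_01_one_mem hn _ _ _
  · exact monoClass_02_one_mem hn _ _ _
  · exact h1 _ _ (monoClass_01_one_mem hn _ _ _)
  · exact h0 _
  · exact monoClass_12_one_mem hn _ _ _
  · exact h1 _ _ (monoClass_02_one_mem hn _ _ _)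
  · exact h1 _ _ (monoClass_12_one_mem hn _ _ _)
  · exact h0 _

/-- Hadamard's lemma writes h as h(0) + ∑ x_i G_i. The constant part is a monomial form, and each
remaining term raises the monomial degree by one, until degree 4 is reached and the class vanishes.
The number d bounds the steps still needed. -/
theorem monoClass_mem (d : ℕ) (k l : Fin 3) (h : smoothFns n) (a b c : ℕ)
    (hd : 4 ≤ a + b + c + d) : monoClass hn k l h a b c ∈ bigSpan hn := by
  induction d generalizing h a b c with
  | zero => rw [monoClass_eq_zero _ _ _ _ _ _ _ (by omega)]; exact zero_mem _
  | succ d ih =>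
    obtain ⟨G, hG, hsum⟩ := exists_eventually_eq_add_sum_mul h.2
    let H : Fin (2 * n) → smoothFns n := fun i => ⟨G i, hG i⟩
    have key : monoClass hn k l h a b c = h.1 0 • monoClass hn k l 1 a b c +
        ∑ i, coefClass (W9 hn) (idx hn k) (idx hn l)
          (X hn 0 ^ a * X hn 1 ^ b * X hn 2 ^ c * (coord i * H i)) := by
      rw [monoClass, monoClass, ← map_smul, ← map_sum, ← map_add]
      refine coefClass_congr _ _ ?_
      filter_upwards [hsum] with x hx
      have hs : ∀ t : Finset (Fin (2 * n)),
          (∑ i ∈ t, X hn 0 ^ a * X hn 1 ^ b * X hn 2 ^ c * (coord i * H i)).1 x =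
            (X hn 0 ^ a * X hn 1 ^ b * X hn 2 ^ c).1 x * ∑ i ∈ t, x i * G i x := fun t => by
        classical
        induction t using Finset.induction_on with
        | empty => simp
        | insert i t hi iht =>
          rw [Finset.sum_insert hi, Finset.sum_insert hi, mul_add, ← iht]
          rfl
      change (X hn 0 ^ a * X hn 1 ^ b * X hn 2 ^ c).1 x * h.1 x =
        h.1 0 * ((X hn 0 ^ a * X hn 1 ^ b * X hn 2 ^ c).1 x * 1) +
        (∑ i, X hn 0 ^ a * X hn 1 ^ b * X hn 2 ^ c * (coord i * H i)).1 x
      rw [hs, hx]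
      ring
    rw [key]
    refine add_mem (Submodule.smul_mem _ _ (monoClass_one_mem hn _ _ _ _ _)) (sum_mem fun i _ => ?_)
    -- Coordinates beyond x₃ vanish on `W9`, so their terms contribute nothing.
    by_cases hi : 3 ≤ (i : ℕ)
    · rw [coefClass_eq_zero _ _ (Eventually.of_forall fun x hx => ?_)]
      · exact zero_mem _
      · change (X hn 0 ^ a * X hn 1 ^ b * X hn 2 ^ c).1 x * (x i * G i x) = 0
        rw [hx.2.2 i hi]
        ring
    · have hik : i = idx hn 0 ∨ i = idx hn 1 ∨ i = idx hn 2 := by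
        simp only [idx, Fin.ext_iff, Fin.val_castLE, Fin.val_zero, Fin.val_one, Fin.val_two]
        omega
      rcases hik with rfl | rfl | rfl
      · have := ih (H (idx hn 0)) (a + 1) b c (by omega)
        rw [monoClass] at this
        convert this using 2
        change _ * (X hn 0 * _) = _
        ring
      · have := ih (H (idx hn 1)) a (b + 1) c (by omega)
        rw [monoClass] at this
        convert this using 2
        change _ * (X hn 1 * _) = _
        ring
      · have := ih (H (idx hn 2)) a b (c + 1) (by omega)
        rw [monoClass] at this
        convert this using 2
        change _ * (X hn 2 * _) = _
        ring

theorem coefClass_mem (i j : Fin (2 * n)) (g : smoothFns n) :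
    coefClass (W9 hn) i j g ∈ bigSpan hn := by
  by_cases hj : 3 ≤ (j : ℕ)
  · rw [coefClass_eq_zero_right hn hj]; exact zero_mem _
  by_cases hi : 3 ≤ (i : ℕ)
  · rw [coefClass_swap, coefClass_eq_zero_right hn hi, neg_zero]; exact zero_mem _
  have := monoClass_mem hn 4 ⟨i, by omega⟩ ⟨j, by omega⟩ g 0 0 0 (by omega)
  rw [monoClass, pow_zero, pow_zero, pow_zero, one_mul, one_mul, one_mul] at this
  exact this

theorem algRestr_mem_bigSpan (ω : Form n 2) : algRestr (W9 hn) ω ∈ bigSpan hn := by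
  let g : Fin (2 * n) → Fin (2 * n) → smoothFns n := fun i j =>
    ⟨fun x => ω.toFun x ![Pi.single i 1, Pi.single j 1] / 2, by
      filter_upwards [ω.smooth] with x hx
      exact ContDiffAt.div_const (((ContinuousAlternatingMap.apply ℝ (R2n n) ℝ
        (![Pi.single i 1, Pi.single j 1] : Fin 2 → R2n n)).contDiff.contDiffAt).comp x hx) 2⟩
  have h : algRestr (W9 hn) ω = ∑ i, ∑ j, coefClass (W9 hn) i j (g i j) := by
    have h1 : ω = ∑ i, ∑ j, smulConst (wedge (dx i) (dx j)) (g i j) := by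
      ext1
      funext x
      have h2 := eq_half_sum_wedge (ω.toFun x)
      let ev : Form n 2 →+ R2n n [⋀^Fin 2]→L[ℝ] ℝ :=
        { toFun := fun η => η.toFun x, map_zero' := rfl, map_add' := fun _ _ => rfl }
      change ev ω = ev _
      simp only [map_sum]
      exact h2
    nth_rw 1 [h1]
    simp only [algRestr, map_sum]
    rfl
  rw [h]
  exact sum_mem fun i _ => sum_mem fun j _ => coefClass_mem hn i j _

end Spanning

/-! ### Taylor coefficients along the two branches of `W9` -/

section TaylorAlongBranches

/-- The Taylor coefficient at `0` of order `k`. -/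
def taylorCoeff (k : ℕ) (φ : ℝ → ℝ) : ℝ := iteratedDeriv k φ 0 / k.factorial

section TaylorCoeff

variable {φ ψ : ℝ → ℝ}

theorem taylorCoeff_congr (k : ℕ) (h : φ =ᶠ[𝓝 0] ψ) : taylorCoeff k φ = taylorCoeff k ψ := by
  rw [taylorCoeff, taylorCoeff, h.iteratedDeriv_eq]

theorem taylorCoeff_zero (φ : ℝ → ℝ) : taylorCoeff 0 φ = φ 0 := by simp [taylorCoeff]

theorem taylorCoeff_deriv (k : ℕ) (φ : ℝ → ℝ) :
    taylorCoeff k (deriv φ) = (k + 1) * taylorCoeff (k + 1) φ := by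
  rw [taylorCoeff, taylorCoeff, iteratedDeriv_succ', Nat.factorial_succ]
  push_cast
  field_simp

theorem taylorCoeff_add (k : ℕ) (hφ : ContDiffAt ℝ (⊤ : ℕ∞) φ 0)
    (hψ : ContDiffAt ℝ (⊤ : ℕ∞) ψ 0) :
    taylorCoeff k (fun t => φ t + ψ t) = taylorCoeff k φ + taylorCoeff k ψ := by
  have h := iteratedDeriv_add (n := k) (hφ.of_le (by exact_mod_cast le_top))
    (hψ.of_le (by exact_mod_cast le_top))
  rw [taylorCoeff, taylorCoeff, taylorCoeff, ← add_div, ← h]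
  rfl

theorem taylorCoeff_const_mul (k : ℕ) (c : ℝ) (φ : ℝ → ℝ) :
    taylorCoeff k (fun t => c * φ t) = c * taylorCoeff k φ := by
  rw [taylorCoeff, taylorCoeff, iteratedDeriv_const_mul_field, mul_div_assoc]

theorem contDiffAt_deriv (hφ : ContDiffAt ℝ (⊤ : ℕ∞) φ 0) :
    ContDiffAt ℝ (⊤ : ℕ∞) (deriv φ) 0 :=
  (hφ.fderiv_right (m := (⊤ : ℕ∞)) (by simp)).clm_apply contDiffAt_const

theorem deriv_id_mul (hφ : ContDiffAt ℝ (⊤ : ℕ∞) φ 0) :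
    deriv (fun t => t * φ t) =ᶠ[𝓝 0] fun t => φ t + t * deriv φ t := by
  filter_upwards [(hφ.of_le (m := 1) (by exact_mod_cast le_top)).eventually (by simp)] with t ht
  have : HasDerivAt (fun t => t * φ t) (1 * φ t + t * deriv φ t) t :=
    (hasDerivAt_id' t).mul (ht.differentiableAt (by simp)).hasDerivAt
  rw [this.deriv, one_mul]

theorem contDiffAt_id_mul (hφ : ContDiffAt ℝ (⊤ : ℕ∞) φ 0) :
    ContDiffAt ℝ (⊤ : ℕ∞) (fun t => t * φ t) 0 := contDiffAt_id.mul hφ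

theorem contDiffAt_pow_mul (j : ℕ) (hφ : ContDiffAt ℝ (⊤ : ℕ∞) φ 0) :
    ContDiffAt ℝ (⊤ : ℕ∞) (fun t => t ^ j * φ t) 0 := (contDiffAt_id.pow j).mul hφ

/-- Induction through (tφ)′ = φ + tφ′: passing to derivatives lowers the order by one, for φ′ in
place of φ. -/
theorem taylorCoeff_succ_id_mul (k : ℕ) (hφ : ContDiffAt ℝ (⊤ : ℕ∞) φ 0) :
    taylorCoeff (k + 1) (fun t => t * φ t) = taylorCoeff k φ := by
  induction k generalizing φ with
  | zero =>
    have h := taylorCoeff_deriv 0 (fun t => t * φ t)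
    rw [taylorCoeff_congr _ (deriv_id_mul hφ), taylorCoeff_zero] at h
    rw [taylorCoeff_zero]
    simp at h
    exact h.symm
  | succ k ih =>
    have h := taylorCoeff_deriv (k + 1) (fun t => t * φ t)
    rw [taylorCoeff_congr _ (deriv_id_mul hφ),
      taylorCoeff_add _ hφ (contDiffAt_id_mul (contDiffAt_deriv hφ)), ih (contDiffAt_deriv hφ),
      taylorCoeff_deriv] at h
    push_cast at h
    have hk : (k : ℝ) + 1 + 1 ≠ 0 := by positivity
    apply mul_left_cancel₀ hk
    rw [← h]
    ring

theorem taylorCoeff_pow_mul (j k : ℕ) (hφ : ContDiffAt ℝ (⊤ : ℕ∞) φ 0) :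
    taylorCoeff (k + j) (fun t => t ^ j * φ t) = taylorCoeff k φ := by
  induction j with
  | zero => simp
  | succ j ih =>
    have h : (fun t => t ^ (j + 1) * φ t) = fun t => t * (t ^ j * φ t) := by
      funext t; ring
    rw [h, ← add_assoc, taylorCoeff_succ_id_mul _ (contDiffAt_pow_mul j hφ), ih]

theorem taylorCoeff_pow_mul_of_lt {j k : ℕ} (hk : k < j) (hφ : ContDiffAt ℝ (⊤ : ℕ∞) φ 0) :
    taylorCoeff k (fun t => t ^ j * φ t) = 0 := by
  obtain ⟨i, rfl⟩ := Nat.exists_eq_add_of_lt hk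
  have h : (fun t => t ^ (k + i + 1) * φ t) = fun t => t ^ k * (t ^ (i + 1) * φ t) := by
    funext t; ring
  have h' := taylorCoeff_pow_mul k 0 (contDiffAt_pow_mul (i + 1) hφ)
  rw [zero_add] at h'
  rw [h]
  refine h'.trans ?_
  rw [taylorCoeff_zero]
  simp

theorem taylorCoeff_const_mul_pow (c : ℝ) (k : ℕ) : taylorCoeff k (fun t => c * t ^ k) = c := by
  have h := taylorCoeff_pow_mul (φ := fun _ => c) k 0 contDiffAt_const
  rw [zero_add, taylorCoeff_zero] at h
  simpa [mul_comm] using h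

end TaylorCoeff

variable {n : ℕ} (hn : 2 ≤ n)

/-- The partial derivative with respect to `x₁`, `x₂` or `x₃`. -/
def pd (k : Fin 3) (g : R2n n → ℝ) (x : R2n n) : ℝ := fderiv ℝ g x (Pi.single (idx hn k) 1)

theorem smoothNear_pd {g : R2n n → ℝ} (hg : SmoothNear g) (k : Fin 3) :
    SmoothNear (pd hn k g) := by
  filter_upwards [hg.fderiv] with x hx using hx.clm_apply contDiffAt_const

theorem pd_congr {g g' : R2n n → ℝ} (h : g =ᶠ[𝓝 0] g') (k : Fin 3) :
    pd hn k g =ᶠ[𝓝 0] pd hn k g' := by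
  filter_upwards [h.fderiv (𝕜 := ℝ)] with x hx
  rw [pd, pd, hx]

theorem pd_comm {g : R2n n → ℝ} (hg : SmoothNear g) (k l : Fin 3) :
    pd hn k (pd hn l g) =ᶠ[𝓝 0] pd hn l (pd hn k g) := by
  filter_upwards [hg, hg.fderiv] with x hx hx'
  have hs : IsSymmSndFDerivAt ℝ g x := hx.isSymmSndFDerivAt (by
    rw [minSmoothness_of_isRCLikeNormedField]
    exact WithTop.coe_le_coe.2 (le_top : (2 : ℕ∞) ≤ ⊤))
  have h : ∀ k l, pd hn k (pd hn l g) x =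
      fderiv ℝ (fderiv ℝ g) x (Pi.single (idx hn k) 1) (Pi.single (idx hn l) 1) := fun k l => by
    have h1 := (hx'.differentiableAt (by simp)).hasFDerivAt.clm_apply
      (hasFDerivAt_const (Pi.single (idx hn l) (1 : ℝ) : R2n n) x)
    have h2 : pd hn k (pd hn l g) x = fderiv ℝ (fun y => fderiv ℝ g y (Pi.single (idx hn l) 1)) x
      (Pi.single (idx hn k) 1) := rfl
    rw [h2, h1.fderiv]
    simp
  rw [h, h, hs]

/-- The derivative `∂₁^a ∂₂^b ∂₃^c g (0)`. -/
def jet (a b c : ℕ) (g : R2n n → ℝ) : ℝ :=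
  ((pd hn 0)^[a] ((pd hn 1)^[b] ((pd hn 2)^[c] g))) 0

theorem iterate_pd_congr {g g' : R2n n → ℝ} (h : g =ᶠ[𝓝 0] g') (k : Fin 3) (a : ℕ) :
    (pd hn k)^[a] g =ᶠ[𝓝 0] (pd hn k)^[a] g' := by
  induction a generalizing g g' with
  | zero => exact h
  | succ a ih => exact ih (pd_congr hn h k)

theorem smoothNear_iterate_pd {g : R2n n → ℝ} (hg : SmoothNear g) (k : Fin 3) (a : ℕ) :
    SmoothNear ((pd hn k)^[a] g) := by
  induction a generalizing g with
  | zero => exact hg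
  | succ a ih => exact ih (smoothNear_pd hn hg k)

theorem iterate_pd_comm {g : R2n n → ℝ} (hg : SmoothNear g) (k l : Fin 3) (a : ℕ) :
    (pd hn k)^[a] (pd hn l g) =ᶠ[𝓝 0] pd hn l ((pd hn k)^[a] g) := by
  induction a generalizing g with
  | zero => exact EventuallyEq.refl _ _
  | succ a ih =>
    exact (iterate_pd_congr hn (pd_comm hn hg k l) k a).trans (ih (smoothNear_pd hn hg k))

theorem jet_pd_two (a b c : ℕ) (g : R2n n → ℝ) :
    jet hn a b c (pd hn 2 g) = jet hn a b (c + 1) g := rfl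

theorem jet_pd_one (a b c : ℕ) {g : R2n n → ℝ} (hg : SmoothNear g) :
    jet hn a b c (pd hn 1 g) = jet hn a (b + 1) c g :=
  (iterate_pd_congr hn (iterate_pd_congr hn (iterate_pd_comm hn hg 2 1 c) 1 b) 0 a).eq_of_nhds

/-- A `jet` differentiates in a fixed order, so the innermost ∂₁ has to be moved outwards past the
powers of ∂₃ and ∂₂. -/
theorem jet_pd_zero (a b c : ℕ) {g : R2n n → ℝ} (hg : SmoothNear g) :
    jet hn a b c (pd hn 0 g) = jet hn (a + 1) b c g :=
  (iterate_pd_congr hn ((iterate_pd_congr hn (iterate_pd_comm hn hg 2 0 c) 1 b).trans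
    (iterate_pd_comm hn (smoothNear_iterate_pd hn hg 2 c) 1 0 b)) 0 a).eq_of_nhds

/-- The cuspidal branch of `W₉`. -/
def cusp (t : ℝ) : R2n n :=
  (-t ^ 5) • Pi.single (idx hn 0) 1 + (-t ^ 4) • Pi.single (idx hn 1) 1 +
    t ^ 3 • Pi.single (idx hn 2) 1

/-- The smooth branch of `W₉`. -/
def line (t : ℝ) : R2n n := t • Pi.single (idx hn 2) 1

/-- Taylor coefficients along the cuspidal branch. -/
def cuspCoeff (k : ℕ) (g : R2n n → ℝ) : ℝ := taylorCoeff k fun t => g (cusp hn t)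

/-- Taylor coefficients along the smooth branch. -/
def lineCoeff (k : ℕ) (g : R2n n → ℝ) : ℝ := taylorCoeff k fun t => g (line hn t)

theorem cusp_zero : cusp hn 0 = 0 := by simp [cusp]

theorem line_zero : line hn 0 = 0 := by simp [line]

theorem contDiff_cusp : ContDiff ℝ (⊤ : ℕ∞) (cusp hn) := by
  unfold cusp; fun_prop

theorem contDiff_line : ContDiff ℝ (⊤ : ℕ∞) (line hn) := by
  unfold line; fun_prop

theorem tendsto_cusp : Tendsto (cusp hn) (𝓝 0) (𝓝 0) := by
  have := (contDiff_cusp hn).continuous.tendsto 0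
  rwa [cusp_zero] at this

theorem tendsto_line : Tendsto (line hn) (𝓝 0) (𝓝 0) := by
  have := (contDiff_line hn).continuous.tendsto 0
  rwa [line_zero] at this

theorem contDiffAt_comp_cusp {g : R2n n → ℝ} (hg : SmoothNear g) :
    ContDiffAt ℝ (⊤ : ℕ∞) (fun t => g (cusp hn t)) 0 := by
  refine ContDiffAt.comp (0 : ℝ) ?_ (contDiff_cusp hn).contDiffAt
  rw [cusp_zero]
  exact hg.self_of_nhds

theorem deriv_comp_line {g : R2n n → ℝ} (hg : SmoothNear g) :
    deriv (fun t => g (line hn t)) =ᶠ[𝓝 0] fun t => pd hn 2 g (line hn t) := by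
  filter_upwards [(tendsto_line hn).eventually hg.differentiableAt] with t ht
  have hc : HasDerivAt (line hn) (Pi.single (idx hn 2) 1) t := by
    have h := (hasDerivAt_id' t).smul_const (Pi.single (idx hn 2) (1 : ℝ) : R2n n)
    rw [one_smul] at h
    exact h
  exact (ht.hasFDerivAt.comp_hasDerivAt t hc).deriv

theorem deriv_comp_cusp {g : R2n n → ℝ} (hg : SmoothNear g) :
    deriv (fun t => g (cusp hn t)) =ᶠ[𝓝 0] fun t =>
      3 * (t ^ 2 * pd hn 2 g (cusp hn t)) + (-4 * (t ^ 3 * pd hn 1 g (cusp hn t)) +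
        -5 * (t ^ 4 * pd hn 0 g (cusp hn t))) := by
  filter_upwards [(tendsto_cusp hn).eventually hg.differentiableAt] with t ht
  have hc : HasDerivAt (cusp hn) ((-(5 * t ^ 4)) • Pi.single (idx hn 0) 1 +
      (-(4 * t ^ 3)) • Pi.single (idx hn 1) 1 + (3 * t ^ 2) • Pi.single (idx hn 2) 1) t := by
    have h5 := ((hasDerivAt_pow 5 t).neg).smul_const (Pi.single (idx hn 0) (1 : ℝ) : R2n n)
    have h4 := ((hasDerivAt_pow 4 t).neg).smul_const (Pi.single (idx hn 1) (1 : ℝ) : R2n n)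
    have h3 := (hasDerivAt_pow 3 t).smul_const (Pi.single (idx hn 2) (1 : ℝ) : R2n n)
    exact ((h5.add h4).add h3).congr_deriv (by norm_num)
  have h := (ht.hasFDerivAt.comp_hasDerivAt t hc).deriv
  refine Eq.trans h ?_
  simp only [map_add, map_smul, smul_eq_mul, pd]
  ring

theorem lineCoeff_succ (k : ℕ) {g : R2n n → ℝ} (hg : SmoothNear g) :
    lineCoeff hn (k + 1) g = lineCoeff hn k (pd hn 2 g) / (k + 1) := by
  rw [lineCoeff, lineCoeff, ← taylorCoeff_congr k (deriv_comp_line hn hg), taylorCoeff_deriv]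
  field_simp

theorem cuspCoeff_deriv (k : ℕ) {g : R2n n → ℝ} (hg : SmoothNear g) :
    (k + 1) * cuspCoeff hn (k + 1) g =
      3 * taylorCoeff k (fun t => t ^ 2 * pd hn 2 g (cusp hn t)) +
      (-4 * taylorCoeff k (fun t => t ^ 3 * pd hn 1 g (cusp hn t)) +
        -5 * taylorCoeff k (fun t => t ^ 4 * pd hn 0 g (cusp hn t))) := by
  have h : ∀ (j : ℕ) (l : Fin 3),
      ContDiffAt ℝ (⊤ : ℕ∞) (fun t => t ^ j * pd hn l g (cusp hn t)) 0 := fun j l =>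
    contDiffAt_pow_mul j (contDiffAt_comp_cusp hn (smoothNear_pd hn hg l))
  rw [cuspCoeff, ← taylorCoeff_deriv, taylorCoeff_congr k (deriv_comp_cusp hn hg),
    taylorCoeff_add k (contDiffAt_const.mul (h 2 2))
      ((contDiffAt_const.mul (h 3 1)).add (contDiffAt_const.mul (h 4 0))),
    taylorCoeff_add k (contDiffAt_const.mul (h 3 1)) (contDiffAt_const.mul (h 4 0)),
    taylorCoeff_const_mul, taylorCoeff_const_mul, taylorCoeff_const_mul]

/-- By the chain rule the derivative of g along the cusp is 3t² ∂₃g − 4t³ ∂₂g − 5t⁴ ∂₁g. Comparing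
coefficients of t^(k+4) gives a recursion from which all later coefficients are computed. -/
theorem cuspCoeff_add_five (k : ℕ) {g : R2n n → ℝ} (hg : SmoothNear g) :
    cuspCoeff hn (k + 5) g = (3 * cuspCoeff hn (k + 2) (pd hn 2 g) -
      4 * cuspCoeff hn (k + 1) (pd hn 1 g) - 5 * cuspCoeff hn k (pd hn 0 g)) / (k + 5) := by
  have h := cuspCoeff_deriv hn (k + 4) hg
  have hs := fun l => contDiffAt_comp_cusp hn (smoothNear_pd hn hg l)
  rw [taylorCoeff_pow_mul 2 (k + 2) (hs 2), taylorCoeff_pow_mul 3 (k + 1) (hs 1),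
    taylorCoeff_pow_mul 4 k (hs 0)] at h
  rw [eq_div_iff (by positivity)]
  simp only [cuspCoeff] at h ⊢
  push_cast at h
  linarith

theorem cuspCoeff_small {g : R2n n → ℝ} (hg : SmoothNear g) :
    cuspCoeff hn 0 g = jet hn 0 0 0 g ∧ cuspCoeff hn 1 g = 0 ∧ cuspCoeff hn 2 g = 0 ∧
      cuspCoeff hn 3 g = jet hn 0 0 1 g ∧ cuspCoeff hn 4 g = -jet hn 0 1 0 g := by
  have hs := fun l => contDiffAt_comp_cusp hn (smoothNear_pd hn hg l)
  have h0 : ∀ g : R2n n → ℝ, cuspCoeff hn 0 g = g 0 := fun g => by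
    rw [cuspCoeff, taylorCoeff_zero, cusp_zero]
  have hz : ∀ (k : ℕ) (l : Fin 3) (j : ℕ), k < j →
      taylorCoeff k (fun t => t ^ j * pd hn l g (cusp hn t)) = 0 := fun k l j hk =>
    taylorCoeff_pow_mul_of_lt hk (hs l)
  have hp : ∀ (j : ℕ) (l : Fin 3),
      taylorCoeff j (fun t => t ^ j * pd hn l g (cusp hn t)) = pd hn l g 0 := fun j l => by
    have := taylorCoeff_pow_mul j 0 (hs l)
    rw [zero_add, taylorCoeff_zero, cusp_zero] at this
    exact this
  have h1 : ∀ l, cuspCoeff hn 1 (pd hn l g) = 0 := fun l => by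
    have := cuspCoeff_deriv hn 0 (smoothNear_pd hn hg l)
    have hs' := fun l' => contDiffAt_comp_cusp hn (smoothNear_pd hn (smoothNear_pd hn hg l) l')
    rw [taylorCoeff_pow_mul_of_lt (by norm_num) (hs' 2),
      taylorCoeff_pow_mul_of_lt (by norm_num) (hs' 1),
      taylorCoeff_pow_mul_of_lt (by norm_num) (hs' 0)] at this
    simpa using this
  refine ⟨h0 g, ?_, ?_, ?_, ?_⟩
  · have := cuspCoeff_deriv hn 0 hg
    rw [hz _ _ _ (by norm_num), hz _ _ _ (by norm_num), hz _ _ _ (by norm_num)] at this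
    simpa using this
  · have := cuspCoeff_deriv hn 1 hg
    rw [hz _ _ _ (by norm_num), hz _ _ _ (by norm_num), hz _ _ _ (by norm_num)] at this
    norm_num at this
    exact this
  · have := cuspCoeff_deriv hn 2 hg
    rw [hp, hz _ _ _ (by norm_num), hz _ _ _ (by norm_num)] at this
    norm_num at this
    exact this
  · have := cuspCoeff_deriv hn 3 hg
    rw [hp, taylorCoeff_pow_mul 2 1 (hs 2), hz _ _ _ (by norm_num)] at this
    have h1' := h1 2
    rw [cuspCoeff] at h1'
    rw [h1'] at this
    norm_num at this
    change _ = -pd hn 1 g 0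
    linarith

end TaylorAlongBranches

/-! ### Nonvanishing of the classes θ₈ and θ₉ -/

section Nonvanishing

variable {n : ℕ} (hn : 2 ≤ n)

section CuspCoeff

variable {g : R2n n → ℝ}

/-- This and the following coefficients are instances of one pattern: the coefficient of t^k is the
sum of (−1)^(a+b) ∂₁^a ∂₂^b ∂₃^c g(0) / (a! b! c!) over 5a + 4b + 3c = k. -/
theorem cuspCoeff_five (hg : SmoothNear g) : cuspCoeff hn 5 g = -jet hn 1 0 0 g := by
  have h := cuspCoeff_add_five hn 0 hg
  norm_num at h
  rw [h, (cuspCoeff_small hn (smoothNear_pd hn hg 2)).2.2.1,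
    (cuspCoeff_small hn (smoothNear_pd hn hg 1)).2.1,
    (cuspCoeff_small hn (smoothNear_pd hn hg 0)).1, jet_pd_zero hn _ _ _ hg]
  ring

theorem cuspCoeff_six (hg : SmoothNear g) : cuspCoeff hn 6 g = jet hn 0 0 2 g / 2 := by
  have h := cuspCoeff_add_five hn 1 hg
  norm_num at h
  rw [h, (cuspCoeff_small hn (smoothNear_pd hn hg 2)).2.2.2.1,
    (cuspCoeff_small hn (smoothNear_pd hn hg 1)).2.2.1,
    (cuspCoeff_small hn (smoothNear_pd hn hg 0)).2.1, jet_pd_two hn]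
  ring

theorem cuspCoeff_seven (hg : SmoothNear g) : cuspCoeff hn 7 g = -jet hn 0 1 1 g := by
  have h := cuspCoeff_add_five hn 2 hg
  norm_num at h
  rw [h, (cuspCoeff_small hn (smoothNear_pd hn hg 2)).2.2.2.2,
    (cuspCoeff_small hn (smoothNear_pd hn hg 1)).2.2.2.1,
    (cuspCoeff_small hn (smoothNear_pd hn hg 0)).2.2.1, jet_pd_two hn, jet_pd_one hn _ _ _ hg]
  ring

theorem cuspCoeff_eight (hg : SmoothNear g) : cuspCoeff hn 8 g = -jet hn 1 0 1 g + jet hn 0 2 0 g / 2 := by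
  have h := cuspCoeff_add_five hn 3 hg
  norm_num at h
  rw [h, cuspCoeff_five hn (smoothNear_pd hn hg 2),
    (cuspCoeff_small hn (smoothNear_pd hn hg 1)).2.2.2.2,
    (cuspCoeff_small hn (smoothNear_pd hn hg 0)).2.2.2.1, jet_pd_two hn, jet_pd_one hn _ _ _ hg,
    jet_pd_zero hn _ _ _ hg]
  ring

theorem cuspCoeff_nine (hg : SmoothNear g) : cuspCoeff hn 9 g = jet hn 0 0 3 g / 6 + jet hn 1 1 0 g := by
  have h := cuspCoeff_add_five hn 4 hg
  norm_num at h
  rw [h, cuspCoeff_six hn (smoothNear_pd hn hg 2), cuspCoeff_five hn (smoothNear_pd hn hg 1),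
    (cuspCoeff_small hn (smoothNear_pd hn hg 0)).2.2.2.2, jet_pd_two hn, jet_pd_one hn _ _ _ hg,
    jet_pd_zero hn _ _ _ hg]
  ring

theorem cuspCoeff_ten (hg : SmoothNear g) : cuspCoeff hn 10 g = -jet hn 0 1 2 g / 2 + jet hn 2 0 0 g / 2 := by
  have h := cuspCoeff_add_five hn 5 hg
  norm_num at h
  rw [h, cuspCoeff_seven hn (smoothNear_pd hn hg 2), cuspCoeff_six hn (smoothNear_pd hn hg 1),
    cuspCoeff_five hn (smoothNear_pd hn hg 0), jet_pd_two hn, jet_pd_one hn _ _ _ hg,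
    jet_pd_zero hn _ _ _ hg]
  ring

theorem cuspCoeff_eleven (hg : SmoothNear g) : cuspCoeff hn 11 g = -jet hn 1 0 2 g / 2 + jet hn 0 2 1 g / 2 := by
  have h := cuspCoeff_add_five hn 6 hg
  norm_num at h
  rw [h, cuspCoeff_eight hn (smoothNear_pd hn hg 2), cuspCoeff_seven hn (smoothNear_pd hn hg 1),
    cuspCoeff_six hn (smoothNear_pd hn hg 0), jet_pd_two hn, jet_pd_two hn, jet_pd_one hn _ _ _ hg,
    jet_pd_zero hn _ _ _ hg]
  ring

theorem cuspCoeff_thirteen (hg : SmoothNear g) :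
    cuspCoeff hn 13 g = -jet hn 0 1 3 g / 6 + jet hn 2 0 1 g / 2 - jet hn 1 2 0 g / 2 := by
  have h := cuspCoeff_add_five hn 8 hg
  norm_num at h
  rw [h, cuspCoeff_ten hn (smoothNear_pd hn hg 2), cuspCoeff_nine hn (smoothNear_pd hn hg 1),
    cuspCoeff_eight hn (smoothNear_pd hn hg 0), jet_pd_two hn, jet_pd_two hn,
    jet_pd_one hn _ _ _ hg, jet_pd_one hn _ _ _ hg, jet_pd_zero hn _ _ _ hg,
    jet_pd_zero hn _ _ _ hg]
  ring

theorem lineCoeff_three (hg : SmoothNear g) : lineCoeff hn 3 g = jet hn 0 0 3 g / 6 := by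
  have h := smoothNear_pd hn hg 2
  have h' := smoothNear_pd hn h 2
  rw [lineCoeff_succ hn 2 hg, lineCoeff_succ hn 1 h, lineCoeff_succ hn 0 h', lineCoeff,
    taylorCoeff_zero, line_zero]
  change pd hn 2 (pd hn 2 (pd hn 2 g)) 0 / _ / _ / _ = pd hn 2 (pd hn 2 (pd hn 2 g)) 0 / 6
  norm_num
  ring

theorem lineCoeff_four (hg : SmoothNear g) : lineCoeff hn 4 g = jet hn 0 0 4 g / 24 := by
  rw [lineCoeff_succ hn 3 hg, lineCoeff_three hn (smoothNear_pd hn hg 2), jet_pd_two]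
  norm_num
  ring

end CuspCoeff

theorem cusp_apply (t : ℝ) : cusp hn t (idx hn 0) = -t ^ 5 ∧ cusp hn t (idx hn 1) = -t ^ 4 ∧
    cusp hn t (idx hn 2) = t ^ 3 := by
  simp [cusp, idx, Fin.ext_iff]

theorem line_apply (t : ℝ) : line hn t (idx hn 0) = 0 ∧ line hn t (idx hn 1) = 0 ∧
    line hn t (idx hn 2) = t := by
  simp [line, idx, Fin.ext_iff]

theorem single_idx_apply_eq_zero (k : Fin 3) {j : Fin (2 * n)} (hj : 3 ≤ (j : ℕ)) :
    (Pi.single (idx hn k) 1 : R2n n) j = 0 := by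
  rw [Pi.single_apply, if_neg]
  intro h
  rw [h] at hj
  exact absurd k.isLt (not_lt.2 hj)

theorem cusp_mem (t : ℝ) : cusp hn t ∈ W9 hn := by
  obtain ⟨h0, h1, h2⟩ := cusp_apply hn t
  refine ⟨?_, ?_, fun j hj => ?_⟩
  · rw [h0, h1, h2]; ring
  · rw [h0, h1, h2]; ring
  · simp [cusp, single_idx_apply_eq_zero hn _ hj]

theorem line_mem (t : ℝ) : line hn t ∈ W9 hn := by
  obtain ⟨h0, h1, h2⟩ := line_apply hn t
  refine ⟨?_, ?_, fun j hj => ?_⟩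
  · rw [h0, h1, h2]; ring
  · rw [h0, h1, h2]; ring
  · simp [line, single_idx_apply_eq_zero hn _ hj]

theorem cuspCoeff_eq {g G : R2n n → ℝ} {c : ℝ} {k : ℕ}
    (h : ∀ᶠ x in 𝓝 0, x ∈ W9 hn → g x = G x) (hc : ∀ t, G (cusp hn t) = c * t ^ k) :
    cuspCoeff hn k g = c := by
  rw [cuspCoeff, taylorCoeff_congr k (ψ := fun t => c * t ^ k), taylorCoeff_const_mul_pow]
  filter_upwards [(tendsto_cusp hn).eventually h] with t ht
  rw [ht (cusp_mem hn t), hc]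

theorem lineCoeff_eq {g G : R2n n → ℝ} {c : ℝ} {k : ℕ}
    (h : ∀ᶠ x in 𝓝 0, x ∈ W9 hn → g x = G x) (hc : ∀ t, G (line hn t) = c * t ^ k) :
    lineCoeff hn k g = c := by
  rw [lineCoeff, taylorCoeff_congr k (ψ := fun t => c * t ^ k), taylorCoeff_const_mul_pow]
  filter_upwards [(tendsto_line hn).eventually h] with t ht
  rw [ht (line_mem hn t), hc]

/-- If `ω` has zero algebraic restriction, then `i_E ω` agrees along `W₉` with the differential of
a function vanishing on `W₉`. -/
theorem exists_fderiv_eq_of_algRestr_eq_zero {ω : Form n 2} (hω : algRestr (W9 hn) ω = 0) :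
    ∃ h : R2n n → ℝ, SmoothNear h ∧ ∀ᶠ x in 𝓝 0, x ∈ W9 hn →
      ∀ v, fderiv ℝ h x v = ω.toFun x ![w9Euler hn x, v] := by
  obtain ⟨α, β, hα, hβ, h⟩ := algRestr_eq_zero_iff.1 hω
  have hX : ∀ x, (w9Field hn 0).toFun x = w9Euler hn x := fun x => one_smul ℝ (w9Euler hn x)
  let ev := ContinuousAlternatingMap.apply ℝ (R2n n) ℝ (![] : Fin 0 → R2n n)
  -- With ω = α + dβ, Cartan's formula gives i_E dβ = L_E β − d(i_E β). Along `W9` both α and L_E β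
  -- vanish, so h = −i_E β works.
  refine ⟨fun x => -ev ((Form.interior (w9Field hn 0) β).toFun x), ?_, ?_⟩
  · filter_upwards [(Form.interior (w9Field hn 0) β).smooth] with x hx
    exact (ev.contDiff.contDiffAt.comp x hx).neg
  · filter_upwards [(Form.interior (w9Field hn 0) β).smooth.differentiableAt,
      (w9Field hn 0).smooth.differentiableAt, β.smooth.differentiableAt, hα, hβ, h,
      VanishesOn.fderiv_w9Field hn 0 β.smooth hβ] with x hx hXd hβd hαx hβx hx' hfd hxN v
    have h1 : fderiv ℝ (fun x => -ev ((Form.interior (w9Field hn 0) β).toFun x)) x v =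
        -(fderiv ℝ (Form.interior (w9Field hn 0) β).toFun x v ![]) := by
      have h2 : HasFDerivAt (fun x => -ev ((Form.interior (w9Field hn 0) β).toFun x))
          (-(ev ∘L fderiv ℝ (Form.interior (w9Field hn 0) β).toFun x)) x :=
        (HasFDerivAt.comp (F := R2n n [⋀^Fin 0]→L[ℝ] ℝ) x ev.hasFDerivAt hx.hasFDerivAt).neg
      rw [h2.fderiv]
      rfl
    rw [h1, fderiv_interior _ _ hXd hβd, hx', Form.toFun_add, Pi.add_apply, hαx hxN, hβx hxN]
    have h3 := hfd hxN
    rw [hX] at h3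
    simp [Form.d_apply_one, h3, hX]

theorem single_idx_apply (k l : Fin 3) :
    (Pi.single (idx hn k) 1 : R2n n) (idx hn l) = if l = k then 1 else 0 := by
  rw [Pi.single_apply]
  congr 1
  simp [idx]

theorem w9Euler_idx (x : R2n n) (k : Fin 3) :
    w9Euler hn x (idx hn k) = weight k * x (idx hn k) := w9Euler_apply hn x _

/-- The index 8 stands for θ₉. If it were zero, some h would satisfy dh = x₃³(4x₂ dx₃ − 3x₃ dx₂)
along `W9`. This has weight 16, so ∂₁h and ∂₃h are tested in orders 11 and 13 on the cusp, and ∂₂h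
in order 4 on the line. -/
theorem theta_eight_ne_zero : theta hn 8 ≠ 0 := by
  intro h0
  obtain ⟨h, hs, hd⟩ := exists_fderiv_eq_of_algRestr_eq_zero hn h0
  have hpd : ∀ k, ∀ᶠ x in 𝓝 0, x ∈ W9 hn → pd hn k h x =
      x (idx hn 2) ^ 3 * (4 * x (idx hn 1) * (if 2 = k then 1 else 0) -
        (if 1 = k then 1 else 0) * (3 * x (idx hn 2))) := fun k => by
    filter_upwards [hd] with x hx hxN
    refine (hx hxN _).trans ?_
    change (x (idx hn 2) ^ 3 • dxdx hn 1 2) _ = _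
    simp [dxdx, wedge_apply, w9Euler_idx, single_idx_apply, weight]
  have e0 := cuspCoeff_eq hn (c := 0) (k := 11) (hpd 0) fun t => by simp
  have e2 := cuspCoeff_eq hn (c := -4) (k := 13) (hpd 2) fun t => by
    simp [(cusp_apply hn t).2]; ring
  have e1 := lineCoeff_eq hn (c := -3) (k := 4) (hpd 1) fun t => by
    simp [(line_apply hn t).2]; ring
  rw [cuspCoeff_eleven hn (smoothNear_pd hn hs 0), jet_pd_zero hn _ _ _ hs,
    jet_pd_zero hn _ _ _ hs] at e0
  rw [cuspCoeff_thirteen hn (smoothNear_pd hn hs 2), jet_pd_two, jet_pd_two, jet_pd_two] at e2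
  rw [lineCoeff_four hn (smoothNear_pd hn hs 1), jet_pd_one hn _ _ _ hs] at e1
  norm_num at e0 e1 e2
  -- The line gives ∂₂∂₃⁴h(0) = −72, and `e0` cancels the other two terms of `e2`, which then reads
  -- 12 = −4.
  linarith

/-- The index 7 stands for θ₈. The table cannot help here, since every X_i with i ≥ 1 kills θ₈. The
argument for θ₉ is repeated in weight 14, with dh = x₃²(5x₁ dx₃ − 3x₃ dx₁) along `W9`. -/
theorem theta_seven_ne_zero : theta hn 7 ≠ 0 := by
  intro h0
  obtain ⟨h, hs, hd⟩ := exists_fderiv_eq_of_algRestr_eq_zero hn h0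
  have hpd : ∀ k, ∀ᶠ x in 𝓝 0, x ∈ W9 hn → pd hn k h x =
      x (idx hn 2) ^ 2 * (5 * x (idx hn 0) * (if 2 = k then 1 else 0) -
        (if 0 = k then 1 else 0) * (3 * x (idx hn 2))) := fun k => by
    filter_upwards [hd] with x hx hxN
    refine (hx hxN _).trans ?_
    change (x (idx hn 2) ^ 2 • dxdx hn 0 2) _ = _
    simp [dxdx, wedge_apply, w9Euler_idx, single_idx_apply, weight]
  have e0 := cuspCoeff_eq hn (c := -3) (k := 9) (hpd 0) fun t => by
    simp [(cusp_apply hn t).2]; ring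
  have e1 := cuspCoeff_eq hn (c := 0) (k := 10) (hpd 1) fun t => by simp
  have e2 := cuspCoeff_eq hn (c := -5) (k := 11) (hpd 2) fun t => by
    simp [cusp_apply hn t]; ring
  have e3 := lineCoeff_eq hn (c := -3) (k := 3) (hpd 0) fun t => by
    simp [line_apply hn t]; ring
  rw [cuspCoeff_nine hn (smoothNear_pd hn hs 0), jet_pd_zero hn _ _ _ hs,
    jet_pd_zero hn _ _ _ hs] at e0
  rw [cuspCoeff_ten hn (smoothNear_pd hn hs 1), jet_pd_one hn _ _ _ hs,
    jet_pd_one hn _ _ _ hs] at e1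
  rw [cuspCoeff_eleven hn (smoothNear_pd hn hs 2), jet_pd_two, jet_pd_two] at e2
  rw [lineCoeff_three hn (smoothNear_pd hn hs 0), jet_pd_zero hn _ _ _ hs] at e3
  norm_num at e0 e1 e2 e3
  -- From `e3`, ∂₁∂₃³h(0) = −18; then `e0` and `e1` force ∂₁²∂₂h(0) = ∂₂²∂₃²h(0) = 0, and `e2`
  -- becomes 9 = −5.
  linarith

end Nonvanishing

/-! ### The nine classes form a basis of the closed restrictions -/

section Basis

variable {n : ℕ} (hn : 2 ≤ n)

/-- Apart from θ₈ and θ₉, each class is carried by a suitable X_i to a nonzero multiple of θ₉, so it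
cannot be zero. -/
theorem theta_ne_zero (j : Fin 9) : theta hn j ≠ 0 := by
  have h8 := theta_eight_ne_zero hn
  have key : ∀ (i : Fin 10) (c : ℝ), c ≠ 0 → w9Lie hn i (theta hn j) = c • theta hn 8 →
      theta hn j ≠ 0 := fun i c hc h h0 => by
    rw [h0, map_zero] at h
    exact smul_ne_zero hc h8 h.symm
  by_cases hj : j = 7
  · exact hj ▸ theta_seven_ne_zero hn
  · fin_cases j
    · exact key 9 16 (by norm_num) (w9Lie_theta hn 9 0)
    · exact key 6 8 (by norm_num) (w9Lie_theta hn 6 1)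
    · exact key 5 4 (by norm_num) (w9Lie_theta hn 5 2)
    · exact key 4 16 (by norm_num) (w9Lie_theta hn 4 3)
    · exact key 3 (-8) (by norm_num) (w9Lie_theta hn 3 4)
    · exact key 2 12 (by norm_num) (w9Lie_theta hn 2 5)
    · exact key 1 16 (by norm_num) (w9Lie_theta hn 1 6)
    · exact absurd rfl hj
    · exact h8

theorem linearIndependent_theta : LinearIndependent ℝ (theta hn) := by
  let μ : Fin 9 → ℝ := ![7, 8, 9, 10, 11, 12, 13, 14, 16]
  have hμ : StrictMono μ := by
    rw [Fin.strictMono_iff_lt_succ]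
    intro i
    fin_cases i <;> simp [μ] <;> norm_num
  refine Module.End.eigenvectors_linearIndependent' (w9Lie hn 0) μ hμ.injective (theta hn)
    fun j => ⟨Module.End.mem_eigenspace_iff.2 ?_, theta_ne_zero hn j⟩
  rw [w9Lie_theta]
  fin_cases j <;> rfl

theorem d_smulConst_apply {ω : Form n 2} {g : R2n n → ℝ} {τ : R2n n [⋀^Fin 2]→L[ℝ] ℝ}
    (hω : ∀ x, ω.toFun x = g x • τ) {x : R2n n} {g' : R2n n →L[ℝ] ℝ} (hg : HasFDerivAt g g' x)
    (v : Fin 3 → R2n n) :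
    ω.d.toFun x v = g' (v 0) * τ ![v 1, v 2] - g' (v 1) * τ ![v 0, v 2] +
      g' (v 2) * τ ![v 0, v 1] := by
  have h : HasFDerivAt ω.toFun (g'.smulRight τ) x := by
    rw [funext hω]
    exact HasFDerivAt.smul_const (F := R2n n [⋀^Fin 2]→L[ℝ] ℝ) hg τ
  rw [Form.d_apply_two, h.fderiv]
  simp

theorem w9Form_mem_closedForms (j : Fin 9) : w9Form hn j ∈ closedForms n 2 := by
  have key : ∀ (k l : Fin 3) (a b c : ℕ),
      (∀ x, w9FormAt hn x j = monoAt hn a b c x • dxdx hn k l) →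
      (∀ (x : R2n n) (v : Fin 3 → R2n n), dmonoAt hn a b c x (v 0) * dxdx hn k l ![v 1, v 2] -
        dmonoAt hn a b c x (v 1) * dxdx hn k l ![v 0, v 2] +
        dmonoAt hn a b c x (v 2) * dxdx hn k l ![v 0, v 1] = 0) →
      w9Form hn j ∈ closedForms n 2 := fun k l a b c h h0 => Eventually.of_forall fun x => by
    ext v
    rw [d_smulConst_apply h (hasFDerivAt_monoAt hn a b c x), h0]
    rfl
  by_cases hj : j = 5
  · subst hj
    have h0 : w9Form hn 5 = smulConst (dxdx hn 1 2) (X hn 0) + smulConst (dxdx hn 0 2) (X hn 1) :=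
      rfl
    rw [h0]
    refine Filter.Eventually.mono (Form.d_add_eventuallyEq (smulConst (dxdx hn 1 2) (X hn 0))
      (smulConst (dxdx hn 0 2) (X hn 1))) fun x hx => ?_
    rw [hx]
    ext v
    rw [Form.toFun_add, Pi.add_apply, ContinuousAlternatingMap.add_apply,
      d_smulConst_apply (g := (X hn 0).1) (fun _ => rfl) (hasFDerivAt_X hn 0 x),
      d_smulConst_apply (g := (X hn 1).1) (fun _ => rfl) (hasFDerivAt_X hn 1 x)]
    simp [dxdx, wedge_apply]
    ring
  · have h1 : ∀ (c : ℕ) (x : R2n n) (v : Fin 3 → R2n n), dmonoAt hn 0 0 c x (v 0) * dxdx hn 1 2 ![v 1, v 2] -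
        dmonoAt hn 0 0 c x (v 1) * dxdx hn 1 2 ![v 0, v 2] +
        dmonoAt hn 0 0 c x (v 2) * dxdx hn 1 2 ![v 0, v 1] = 0 := fun c x v => by
      simp [dxdx, wedge_apply, dmonoAt]
      ring
    have h2 : ∀ (c : ℕ) (x : R2n n) (v : Fin 3 → R2n n), dmonoAt hn 0 0 c x (v 0) * dxdx hn 0 2 ![v 1, v 2] -
        dmonoAt hn 0 0 c x (v 1) * dxdx hn 0 2 ![v 0, v 2] +
        dmonoAt hn 0 0 c x (v 2) * dxdx hn 0 2 ![v 0, v 1] = 0 := fun c x v => by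
      simp [dxdx, wedge_apply, dmonoAt]
      ring
    fin_cases j
    · exact key _ _ 0 0 0 (fun x => by simp [w9FormAt, monoAt]) (h1 0)
    · exact key _ _ 0 0 0 (fun x => by simp [w9FormAt, monoAt]) (h2 0)
    · exact key 0 1 0 0 0 (fun x => by simp [w9FormAt, monoAt]) fun x v => by simp [dmonoAt]
    · exact key _ _ 0 0 1 (fun x => by simp [w9FormAt, monoAt]) (h1 1)
    · exact key _ _ 0 0 1 (fun x => by simp [w9FormAt, monoAt]) (h2 1)
    · exact absurd rfl hj
    · exact key _ _ 0 0 2 (fun x => by simp [w9FormAt, monoAt]) (h1 2)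
    · exact key _ _ 0 0 2 (fun x => by simp [w9FormAt, monoAt]) (h2 2)
    · exact key _ _ 0 0 3 (fun x => by simp [w9FormAt, monoAt]) (h1 3)

theorem span_theta_eq_map : Submodule.span ℝ (Set.range (theta hn)) =
    (Submodule.span ℝ (Set.range (w9Form hn))).map (zeroRestriction (W9 hn) 1).mkQ := by
  rw [Submodule.map_span, ← Set.range_comp]
  rfl

theorem span_w9Form_le : Submodule.span ℝ (Set.range (w9Form hn)) ≤ closedForms n 2 :=
  Submodule.span_le.2 (Set.range_subset_iff.2 (w9Form_mem_closedForms hn))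

/-- Functions vanishing on `W₉` have no linear part in `x₁, x₂, x₃`. -/
theorem VanishesOn.pd_eq_zero {g : R2n n → ℝ} (hg : SmoothNear g) (hv : VanishesOn g (W9 hn))
    (k : Fin 3) : pd hn k g 0 = 0 := by
  -- Along the cusp the linear terms have orders 3, 4, 5 and quadratic terms start at order 6, so
  -- coefficients 3 to 5 isolate the first partial derivatives.
  have h : ∀ j, cuspCoeff hn j g = 0 := fun j =>
    cuspCoeff_eq hn (G := fun _ => 0) hv fun t => by simp
  have h3 := (cuspCoeff_small hn hg).2.2.2.1
  have h4 := (cuspCoeff_small hn hg).2.2.2.2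
  have h5 := cuspCoeff_five hn hg
  rw [h, zero_eq_neg] at h4 h5
  rw [h] at h3
  fin_cases k
  · exact h5
  · exact h4
  · exact h3.symm

theorem VanishesOn.fderiv_form_eq_zero {α : Form n 2} (hα : VanishesOn α.toFun (W9 hn))
    (k : Fin 3) (v : Fin 2 → R2n n) :
    fderiv ℝ α.toFun 0 (Pi.single (idx hn k) 1) v = 0 := by
  let ev := ContinuousAlternatingMap.apply ℝ (R2n n) ℝ v
  have hs : SmoothNear fun x => α.toFun x v := by
    filter_upwards [α.smooth] with x hx using ev.contDiff.contDiffAt.comp x hx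
  have hv : VanishesOn (fun x => α.toFun x v) (W9 hn) := by
    filter_upwards [hα] with x hx hxN
    rw [hx hxN]
    rfl
  have h1 : HasFDerivAt (fun x => α.toFun x v) (ev ∘L fderiv ℝ α.toFun 0) 0 :=
    HasFDerivAt.comp (F := R2n n [⋀^Fin 2]→L[ℝ] ℝ) 0 ev.hasFDerivAt
      α.smooth.differentiableAt.self_of_nhds.hasFDerivAt
  have h2 := VanishesOn.pd_eq_zero hn hs hv k
  rw [pd, h1.fderiv] at h2
  exact h2

/-- Modulo a closed combination η of the θ_j, the form ω is c x₁ dx₂ ∧ dx₃ + α + dβ with α vanishing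
on `W9`. Applying d and evaluating at the origin forces c = 0. -/
theorem algRestr_mem_span_of_closed {ω : Form n 2} (hω : ω ∈ closedForms n 2) :
    algRestr (W9 hn) ω ∈ Submodule.span ℝ (Set.range (theta hn)) := by
  obtain ⟨s, hs, u, hu, hsu⟩ := Submodule.mem_sup.1 (algRestr_mem_bigSpan hn ω)
  obtain ⟨c, rfl⟩ := Submodule.mem_span_singleton.1 hu
  have hs' := hs
  rw [span_theta_eq_map] at hs'
  obtain ⟨η, hη, rfl⟩ := Submodule.mem_map.1 hs'
  let υ : Form n 2 := smulConst (dxdx hn 1 2) (X hn 0)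
  have hυ : monoClass hn 1 2 1 1 0 0 = algRestr (W9 hn) υ := by
    rw [monoClass_one, pow_one, pow_zero, pow_zero, mul_one, mul_one]
  have hz : ω - η - c • υ ∈ zeroRestriction (W9 hn) 1 := by
    rw [← algRestr_eq_zero_iff]
    have : algRestr (W9 hn) (ω - η - c • υ) = algRestr (W9 hn) ω - algRestr (W9 hn) η -
      c • algRestr (W9 hn) υ := by simp only [algRestr, map_sub, map_smul]
    rw [this, ← hsu, hυ]
    change (algRestr (W9 hn) η + _) - _ - _ = 0
    abel
  obtain ⟨α, β, hα, -, h⟩ := hz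
  have hc0 : ω - η ∈ closedForms n 2 := sub_mem hω (span_w9Form_le hn hη)
  have e : ω - η = (ω - η - c • υ) + c • υ := by abel
  have h1 : (ω - η).d.toFun =ᶠ[𝓝 0] (α.d + β.d.d + c • υ.d).toFun := by
    have h2 := Form.d_add_eventuallyEq (ω - η - c • υ) (c • υ)
    rw [← e] at h2
    have h3 := (Form.d_congr h).trans (Form.d_add_eventuallyEq α β.d)
    filter_upwards [h2, h3] with x h2 h3
    rw [h2]
    simp only [Form.toFun_add, Pi.add_apply] at h3 ⊢
    rw [h3, Form.d_smul]
  have h2 : (0 : R2n n [⋀^Fin 3]→L[ℝ] ℝ) = α.d.toFun 0 + c • υ.d.toFun 0 := by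
    have h3 := h1.eq_of_nhds
    have h4 : (ω - η).d.toFun 0 = 0 := Filter.EventuallyEq.eq_of_nhds hc0
    have h5 : β.d.d.toFun 0 = 0 := Filter.EventuallyEq.eq_of_nhds β.d_d
    rw [h4] at h3
    simp only [Form.toFun_add, Pi.add_apply, h5, Form.toFun_smul, Pi.smul_apply] at h3
    simpa using h3
  -- On these three vectors dx₁ ∧ dx₂ ∧ dx₃ equals 1. The value of dα at 0 is a combination of first
  -- derivatives of α in these directions, all of which vanish.
  have h3 := DFunLike.congr_fun h2 ![Pi.single (idx hn 0) 1, Pi.single (idx hn 1) 1,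
    Pi.single (idx hn 2) 1]
  rw [ContinuousAlternatingMap.add_apply, ContinuousAlternatingMap.smul_apply, Form.d_apply_two,
    d_smulConst_apply (ω := υ) (g := (X hn 0).1) (fun _ => rfl) (hasFDerivAt_X hn 0 0)] at h3
  simp [hα.fderiv_form_eq_zero hn, dxdx, wedge_apply, single_idx_apply] at h3
  rw [← hsu, ← h3, zero_smul, add_zero]
  exact hs

theorem span_theta : Submodule.span ℝ (Set.range (theta hn)) = closedAlgRestr (W9 hn) 1 := by
  refine le_antisymm ?_ ?_
  · rw [span_theta_eq_map]
    exact Submodule.map_mono (span_w9Form_le hn)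
  · rintro _ ⟨ω, hω, rfl⟩
    exact algRestr_mem_span_of_closed hn hω

end Basis

end AlgebraicRestriction

end

open AlgebraicRestriction in
theorem mainTheorem12 (n : ℕ) (hn : 2 ≤ n) :
    let N : Set (R2n n) := W9 hn
    let θ : Fin 9 → AlgRestr N 1 := fun j => algRestr N (w9Form hn j)
    -- the fields are tangent to `N`, and their Lie derivatives act on algebraic restrictions
    (∀ i, IsTangent (w9Field hn i) N) ∧
    (∀ i, ∀ ω ω' : Form n 2, algRestr N ω = algRestr N ω' →
      algRestr N (ω.lie (w9Field hn i)) = algRestr N (ω'.lie (w9Field hn i))) ∧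
    -- the algebraic restrictions of the nine forms are a basis of the closed ones
    (LinearIndependent ℝ θ ∧ Submodule.span ℝ (Set.range θ) = closedAlgRestr N 1) ∧
    -- the table
    (∀ i j, algRestr N ((w9Form hn j).lie (w9Field hn i)) =
      w9Table (θ 0) (θ 1) (θ 2) (θ 3) (θ 4) (θ 5) (θ 6) (θ 7) (θ 8) i j) := by
  intro N θ
  refine ⟨isTangent_w9Field hn, fun i ω ω' h => ?_,
    ⟨linearIndependent_theta hn, span_theta hn⟩, fun i j => w9Lie_theta hn i j⟩
  rw [← w9Lie_algRestr, ← w9Lie_algRestr, h]
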